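/- Write $\lg$ for $\log_2$. There are a word-RAM program $P$ and a constant $C$ such that the following holds for every integer $n \ge 3$ and every word size $w$ with $n < 2^w$ (so that the numbers $0,\dots,n$ fit into one word). For every partition of an $n$-element set into equivalence classes, one can assign to the elements distinct labels from $\{1,\dots,n\}$ and store a data structure of at most $C\,\sqrt n\,\lg n/\lg\lg n$ bits, such that for any two elements the program $P$, given only their labels and the word size $w$, and with read access to the data structure (packed into $w$-bit memory words), determines whether the two elements are in the same equivalence class in at most $C\lg\lg n$ steps. That is, a partition of an $n$-element set can be stored in $O(\sqrt n\,\lg n/\lg\lg n)$ bits such that an equivalence query takes $O(\lg\lg n)$ time. Here a word RAM executes in one step a word load, a jump, a comparison, or an arithmetic (addition, subtraction, multiplication, integer division, remainder), bitwise or shift operation on $w$-bit words; the program uses only a constant number of registers besides the data structure. -/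

import Mathlib

namespace WordRAM

/-- Instructions of a word RAM. The operands `d a b` are indices of registers, `l` is a position in
the program. All arithmetic is on `w`-bit words, that is, modulo `2 ^ w`. -/
inductive Instr : Type
  | const (d k : ℕ)
  | copy (d a : ℕ)
  | add (d a b : ℕ)
  | sub (d a b : ℕ)
  | mul (d a b : ℕ)
  | div (d a b : ℕ)
  | mod (d a b : ℕ)
  | and (d a b : ℕ)
  | or (d a b : ℕ)
  | xor (d a b : ℕ)
  | not (d a : ℕ)
  | shl (d a b : ℕ)
  | shr (d a b : ℕ)
  /-- Read the memory word whose address is in register `a`. -/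
  | load (d a : ℕ)
  | jmp (l : ℕ)
  /-- Jump if register `a` is zero. -/
  | jz (a l : ℕ)
  /-- Jump if register `a` is smaller than register `b`. -/
  | jlt (a b l : ℕ)
  | halt

/-- A program is a finite list of instructions; it refers to finitely many registers, all of them
named explicitly, so its working space is a constant number of words. -/
abbrev Program : Type := List Instr

/-- Program counter and contents of the registers. -/
structure Config : Type where
  pc : ℕ
  reg : ℕ → ℕ

/-- The instruction about to be executed; running past the end of the program is halting. -/
def Program.at (P : Program) (i : ℕ) : Instr := P.getD i Instr.halt

/-- Store `v` (as a `w`-bit word) in register `d` and go to the next instruction. -/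
def Config.put (w : ℕ) (c : Config) (d v : ℕ) : Config where
  pc := c.pc + 1
  reg := Function.update c.reg d (v % 2 ^ w)

/-- Go to position `l` if `p` holds, and to the next instruction otherwise. -/
def Config.branch (c : Config) (p : Prop) [Decidable p] (l : ℕ) : Config where
  pc := if p then l else c.pc + 1
  reg := c.reg

/-- The effect of one instruction, on a machine with word size `w` and read-only memory `mem`. -/
def Instr.exec (w : ℕ) (mem : ℕ → ℕ) (c : Config) : Instr → Config
  | .const d k => c.put w d k
  | .copy d a => c.put w d (c.reg a)
  | .add d a b => c.put w d (c.reg a + c.reg b)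
  | .sub d a b => c.put w d (c.reg a + 2 ^ w - c.reg b)
  | .mul d a b => c.put w d (c.reg a * c.reg b)
  | .div d a b => c.put w d (c.reg a / c.reg b)
  | .mod d a b => c.put w d (c.reg a % c.reg b)
  | .and d a b => c.put w d (c.reg a &&& c.reg b)
  | .or d a b => c.put w d (c.reg a ||| c.reg b)
  | .xor d a b => c.put w d (c.reg a ^^^ c.reg b)
  | .not d a => c.put w d (2 ^ w - 1 - c.reg a)
  | .shl d a b => c.put w d (c.reg a <<< c.reg b)
  | .shr d a b => c.put w d (c.reg a >>> c.reg b)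
  | .load d a => c.put w d (mem (c.reg a))
  | .jmp l => c.branch True l
  | .jz a l => c.branch (c.reg a = 0) l
  | .jlt a b l => c.branch (c.reg a < c.reg b) l
  | .halt => c

/-- One step of the computation, which costs one unit of time. -/
def step (P : Program) (w : ℕ) (mem : ℕ → ℕ) (c : Config) : Config :=
  (P.at c.pc).exec w mem c

/-- A string of bits, packed into consecutive `w`-bit memory words (low-order bits first);
the last word is padded by zeros, and all further words are zero. -/
def packed (w : ℕ) (D : List Bool) (k : ℕ) : ℕ :=
  ∑ i ∈ Finset.range w, (D.getD (k * w + i) false).toNat * 2 ^ i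

/-- Initially registers `0` and `1` hold the two arguments of the query, register `2` holds the word
size of the machine, and all other registers are zero. -/
def init (w x y : ℕ) : Config where
  pc := 0
  reg i := if i = 0 then x else if i = 1 then y else if i = 2 then w else 0

/-- On a machine of word size `w` whose memory holds the bit string `D`, the program `P`, started on
the arguments `x` and `y`, has halted after `t` steps with the answer `ans` in register `0`. -/
def Answers (P : Program) (w : ℕ) (D : List Bool) (x y t ans : ℕ) : Prop :=
  P.at ((step P w (packed w D))^[t] (init w x y)).pc = Instr.halt ∧
    ((step P w (packed w D))^[t] (init w x y)).reg 0 = ans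

/-- The bit string `D`, with the query program `P`, represents the equivalence relation `r` on
elements that are labelled by `label`: on a machine of word size `w`, every equivalence query, given
by the labels of two elements, is answered correctly (`1` for equivalent, `0` for not equivalent)
in at most `T` steps. -/
def Represents {α : Type*} (P : Program) (w : ℕ) (r : Setoid α) (label : α → ℕ) (D : List Bool)
    (T : ℝ) : Prop :=
  ∀ a b : α, ∃ t : ℕ, (t : ℝ) ≤ T ∧
    (r a b → Answers P w D (label a) (label b) t 1) ∧
    (¬ r a b → Answers P w D (label a) (label b) t 0)

end WordRAM

/-! Number the classes of each size and rank the elements lying in classes of size `s`, class after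
class. An element is then given by `(s, u)`, and its class by `(s, u / s)` (`exists_rank`). The data
structure has to recover `(s, u)` from a label, so it needs only the multiplicities `m s`, where the
`s * m s` add up to `n`.

Let `j` be about lg lg n and let a cell have `2 ^ j` bits, about lg n. Distinct sizes add up to at
most `n`, so there are O(√n) of them. A block takes up to `j` sizes from one window of length `2 ^
j`: it stores a base in one cell and, in another, the differences from the base with their
multiplicities, in `j` bits each. Sizes beyond about `j * √n`, or of multiplicity at least `2 ^ j`,
get blocks of their own; there are only O(√n / j) of them, and O(√n / j) windows. So O(√n / j)
blocks suffice (`exists_covers`), which makes O(√n lg n / lg lg n) bits.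

To find the block of a label without a predecessor search, the labels are split into buckets of
equal size, each holding pieces of at most two blocks, as in the alias method (`exists_buckets`).
One division finds the bucket, one comparison the piece, and a scan of at most `j` entries yields
`(s, u)`. Labels are distinct because a position determines `(s, u)`, which determines the element.

Only the word size and the labels are known to the program, so it reads `j` off the memory: the
first cell is `2 ^ j`, and counting its trailing zeros takes O(j) steps (`reaches_trailing_zeros`).
For word sizes below 256, `n` is bounded and a plain array of representatives serves
(`exists_array`). -/

namespace WordRAM

/-! ### Execution of straight-line code and of jumps -/

/-- The instructions that do not change the flow of control. -/
def Instr.Straight : Instr → Prop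
  | .jmp _ | .jz _ _ | .jlt _ _ _ | .halt => False
  | _ => True

/-- The effect of a straight-line piece of code on the registers. -/
def runRegs (w : ℕ) (mem : ℕ → ℕ) (code : List Instr) (reg : ℕ → ℕ) : ℕ → ℕ :=
  code.foldl (fun r ins => (ins.exec w mem ⟨0, r⟩).reg) reg

theorem Program.at_of_drop {P : Program} {pc : ℕ} {ins : Instr} {rest : List Instr}
    (h : P.drop pc = ins :: rest) : P.at pc = ins := by
  have := congrArg (fun l => l.getD 0 Instr.halt) h
  simpa [Program.at, List.getD_eq_getElem?_getD] using this

/-- The position of the code is expressed by `P.drop pc = code ++ rest`, so that for a concrete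
program and a concrete `pc` the hypothesis holds by `rfl`. -/
theorem iterate_straight (P : Program) (w : ℕ) (mem : ℕ → ℕ) (code : List Instr) :
    ∀ (pc : ℕ) (reg : ℕ → ℕ) (rest : List Instr), (∀ ins ∈ code, ins.Straight) →
      P.drop pc = code ++ rest →
      (step P w mem)^[code.length] ⟨pc, reg⟩ = ⟨pc + code.length, runRegs w mem code reg⟩ := by
  induction code with
  | nil => intros; simp [runRegs]
  | cons ins code ih =>
    intro pc reg rest hs h
    have h1 : P.at pc = ins := Program.at_of_drop h
    have h2 : P.drop (pc + 1) = code ++ rest := by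
      rw [← List.drop_drop, h]; rfl
    have h3 : step P w mem ⟨pc, reg⟩ = ⟨pc + 1, (ins.exec w mem ⟨0, reg⟩).reg⟩ := by
      have := hs ins (by simp)
      unfold step
      rw [h1]
      cases ins <;> simp_all [Instr.Straight, Instr.exec, Config.put]
    rw [List.length_cons, Function.iterate_succ_apply, h3,
      ih _ _ rest (fun i hi => hs i (by simp [hi])) h2]
    simp [runRegs, Nat.add_comm, Nat.add_left_comm]

/-- Configuration `c'` is reached from `c` in at most `T` steps. -/
def Reaches (P : Program) (w : ℕ) (mem : ℕ → ℕ) (T : ℕ) (c c' : Config) : Prop :=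
  ∃ t ≤ T, (step P w mem)^[t] c = c'

theorem Reaches.trans {P : Program} {w : ℕ} {mem : ℕ → ℕ} {T T' : ℕ} {c c' c'' : Config}
    (h : Reaches P w mem T c c') (h' : Reaches P w mem T' c' c'') :
    Reaches P w mem (T + T') c c'' := by
  obtain ⟨t, ht, rfl⟩ := h
  obtain ⟨t', ht', rfl⟩ := h'
  exact ⟨t' + t, by omega, Function.iterate_add_apply _ _ _ _⟩

theorem Reaches.mono {P : Program} {w : ℕ} {mem : ℕ → ℕ} {T T' : ℕ} {c c' : Config}
    (h : Reaches P w mem T c c') (hT : T ≤ T') : Reaches P w mem T' c c' := by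
  obtain ⟨t, ht, h⟩ := h
  exact ⟨t, ht.trans hT, h⟩

theorem Reaches.straight {P : Program} {w : ℕ} {mem : ℕ → ℕ} {pc : ℕ} {reg : ℕ → ℕ}
    (code rest : List Instr) (hs : ∀ ins ∈ code, ins.Straight) (h : P.drop pc = code ++ rest) :
    Reaches P w mem code.length ⟨pc, reg⟩ ⟨pc + code.length, runRegs w mem code reg⟩ :=
  ⟨_, le_rfl, iterate_straight P w mem code pc reg rest hs h⟩

theorem Reaches.jmp {P : Program} {w : ℕ} {mem : ℕ → ℕ} {pc l : ℕ} {reg : ℕ → ℕ}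
    (h : P.at pc = .jmp l) : Reaches P w mem 1 ⟨pc, reg⟩ ⟨l, reg⟩ :=
  ⟨1, le_rfl, by simp [step, h, Instr.exec, Config.branch]⟩

theorem Reaches.jz {P : Program} {w : ℕ} {mem : ℕ → ℕ} {pc a l : ℕ} {reg : ℕ → ℕ}
    (h : P.at pc = .jz a l) :
    Reaches P w mem 1 ⟨pc, reg⟩ ⟨if reg a = 0 then l else pc + 1, reg⟩ :=
  ⟨1, le_rfl, by simp [step, h, Instr.exec, Config.branch]⟩

theorem Reaches.jlt {P : Program} {w : ℕ} {mem : ℕ → ℕ} {pc a b l : ℕ} {reg : ℕ → ℕ}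
    (h : P.at pc = .jlt a b l) :
    Reaches P w mem 1 ⟨pc, reg⟩ ⟨if reg a < reg b then l else pc + 1, reg⟩ :=
  ⟨1, le_rfl, by simp [step, h, Instr.exec, Config.branch]⟩

/-! ### Memory as one large number, and cells that straddle words -/

/-- The `L` low-order bits of `Z`. -/
def bitList (L Z : ℕ) : List Bool := (List.range L).map Z.testBit

theorem sum_testBit (a w : ℕ) : ∑ i ∈ Finset.range w, (a.testBit i).toNat * 2 ^ i = a % 2 ^ w := by
  induction w with
  | zero => simp [Nat.mod_one]
  | succ w ih => rw [Finset.sum_range_succ, ih, Nat.mod_pow_succ, Nat.toNat_testBit, mul_comm]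

/-- The whole memory is treated as a single number `Z`: words are its digits in base `2 ^ w`, while
cells will be its digits in base `2 ^ q`. -/
theorem packed_bitList (w : ℕ) {L Z : ℕ} (hZ : Z < 2 ^ L) (k : ℕ) :
    packed w (bitList L Z) k = Z / 2 ^ (k * w) % 2 ^ w := by
  rw [← sum_testBit, packed]
  refine Finset.sum_congr rfl fun i _ => ?_
  congr 2
  rw [← Nat.shiftRight_eq_div_pow, Nat.testBit_shiftRight, bitList, List.getD_eq_getElem?_getD]
  rcases lt_or_ge (k * w + i) L with h | h
  · simp [h]
  · have : Z.testBit (k * w + i) = false :=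
      Nat.testBit_lt_two_pow (hZ.trans_le (Nat.pow_le_pow_right (by norm_num) h))
    simp [h, this]

/-- A field that may straddle two words, assembled from its two parts. -/
theorem straddling_read (Z w p q : ℕ) (hw : 0 < w) (hcell : Z / 2 ^ p % 2 ^ q < 2 ^ w) :
    (Z / 2 ^ (p / w * w) % 2 ^ w / 2 ^ (p % w) |||
        (Z / 2 ^ ((p / w + 1) * w) % 2 ^ w * 2 ^ (w - p % w)) % 2 ^ w) &&&
      ((2 ^ q % 2 ^ w + 2 ^ w - 1) % 2 ^ w) = Z / 2 ^ p % 2 ^ q := by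
  -- A cell may be wider than a word. Then `2 ^ q` vanishes modulo `2 ^ w`, and subtracting 1 wraps
  -- around to the mask of all ones, which is the correct one because the content of the cell fits
  -- into a word.
  have hm : (2 ^ q % 2 ^ w + 2 ^ w - 1) % 2 ^ w = 2 ^ min q w - 1 := by
    rcases lt_or_ge q w with h | h
    · rw [min_eq_left h.le, Nat.mod_eq_of_lt (Nat.pow_lt_pow_right (by norm_num) h)]
      have h1 : 0 < 2 ^ q := by positivity
      have h2 : 2 ^ q < 2 ^ w := Nat.pow_lt_pow_right (by norm_num) h
      rw [show 2 ^ q + 2 ^ w - 1 = (2 ^ q - 1) + 2 ^ w by omega, Nat.add_mod_right,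
        Nat.mod_eq_of_lt (by omega)]
    · rw [min_eq_right h, Nat.mod_eq_zero_of_dvd (pow_dvd_pow 2 h)]
      have h1 : 0 < 2 ^ w := by positivity
      rw [Nat.zero_add, Nat.mod_eq_of_lt (by omega)]
  rw [hm, ← Nat.mod_eq_of_lt hcell]
  have hp : p / w * w + p % w = p := Nat.div_add_mod' p w
  have hlt : p % w < w := Nat.mod_lt _ hw
  refine Nat.eq_of_testBit_eq fun i => ?_
  simp only [← Nat.shiftRight_eq_div_pow, ← Nat.shiftLeft_eq, Nat.testBit_and, Nat.testBit_or,
    Nat.testBit_shiftRight, Nat.testBit_mod_two_pow, Nat.testBit_shiftLeft,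
    Nat.testBit_two_pow_sub_one]
  set s := p % w
  rw [Nat.add_mul, Nat.one_mul]
  generalize p / w * w = b at *
  rcases lt_or_ge i w with hi | hi
  · rcases lt_or_ge i q with hq | hq
    -- Bit `i` of the cell comes from the first word as long as `s + i < w`, and from the second
    -- word afterwards.
    · rcases lt_or_ge (s + i) w with h | h
      · have h1 : ¬ (w - s ≤ i) := by omega
        simp [hi, hq, h, h1, ← hp, add_assoc]
      · have h1 : w - s ≤ i := by omega
        have h2 : i - (w - s) < w := by omega
        have h3 : ¬ (s + i < w) := by omega
        have h4 : b + w + (i - (w - s)) = p + i := by omega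
        simp [hi, hq, h1, h2, h3, h4]
    · simp [hi, not_lt.2 hq]
  · simp [not_lt.2 hi]

theorem ofDigits_two_pow_cell (q : ℕ) (cs : List ℕ) (h : ∀ c ∈ cs, c < 2 ^ q) (i : ℕ) :
    Nat.ofDigits (2 ^ q) cs / 2 ^ (i * q) % 2 ^ q = cs.getD i 0 := by
  induction cs generalizing i with
  | nil => simp
  | cons c cs ih =>
    have hc : c < 2 ^ q := h c (by simp)
    rw [Nat.ofDigits_cons]
    cases i with
    | zero => simp [Nat.mod_eq_of_lt hc]
    | succ i =>
      rw [Nat.add_mul, Nat.one_mul, Nat.add_comm (i * q), pow_add, ← Nat.div_div_eq_div_mul,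
        Nat.add_mul_div_left _ _ (by positivity), Nat.div_eq_of_lt hc, Nat.zero_add,
        ih (fun c hc => h c (by simp [hc]))]
      simp

theorem ofDigits_two_pow_lt (q : ℕ) (cs : List ℕ) (h : ∀ c ∈ cs, c < 2 ^ q) :
    Nat.ofDigits (2 ^ q) cs < 2 ^ (q * cs.length) := by
  induction cs with
  | nil => simp
  | cons c cs ih =>
    have hc : c < 2 ^ q := h c (by simp)
    have := ih fun c hc => h c (by simp [hc])
    rw [Nat.ofDigits_cons, List.length_cons, Nat.mul_succ, pow_add]
    nlinarith [Nat.one_le_two_pow (n := q)]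

/-! ### The query program and the reading of a cell -/

/-- Load the cell whose index is in register `20` into register `21`, where register `5` holds the
width of a cell and register `6` the mask for a cell. -/
def readCell : List Instr :=
  [.mul 21 20 5, .div 22 21 2, .mod 23 21 2, .load 21 22, .shr 21 21 23, .add 22 22 3,
    .load 22 22, .sub 23 2 23, .shl 22 22 23, .or 21 21 22, .and 21 21 6]

/-- The query program. -/
def queryProgram : Program :=
  -- Eight shifts test whether the word size is below 256; the loop at position 12 counts the
  -- trailing zeros of the first word into register 4.
  [.const 3 1, .copy 21 2, .shr 21 21 3, .shr 21 21 3, .shr 21 21 3, .shr 21 21 3, .shr 21 21 3,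
    .shr 21 21 3, .shr 21 21 3, .shr 21 21 3, .jz 21 121, .load 21 9,
    .and 22 21 3, .jlt 9 22 17, .shr 21 21 3, .add 4 4 3, .jmp 12,
    .shl 5 3 4, .shl 6 3 5, .sub 6 6 3, .sub 7 5 3, .copy 20 3] ++
  readCell ++
  -- Register 8 receives the bucket size. Position 34 starts the decoding of the label in register
  -- 0, which runs once for each label.
  [.copy 8 21,
    .sub 25 0 3, .mod 24 25 8, .div 20 25 8, .const 25 6, .mul 20 20 25, .const 25 2,
    .add 20 20 25] ++
  readCell ++
  [.jlt 24 21 57, .sub 24 24 21, .const 25 4, .add 20 20 25, .jmp 71, .add 20 20 3] ++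
  readCell ++
  [.add 24 24 21, .add 20 20 3] ++
  readCell ++
  [.copy 26 21, .add 20 20 3] ++
  readCell ++
  -- The scan of a block: registers 26 and 21 hold the base and the remaining entries, register 24
  -- the remaining rank. It leaves the size in register 27.
  [.jz 21 105, .and 27 21 7, .add 27 27 26, .shr 21 21 4, .and 28 21 7, .shr 21 21 4,
    .mul 28 28 27, .jlt 24 28 106, .sub 24 24 28, .jmp 95, .copy 27 26,
    -- Register 10 is zero in the first pass only; then the result is saved in registers 11 and 12
    -- and the second label is decoded.
    .div 24 24 27, .jlt 9 10 113, .copy 10 3, .copy 11 27, .copy 12 24, .copy 0 1, .jmp 34,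
    .xor 27 27 11, .xor 24 24 12, .or 27 27 24, .jz 27 119, .const 0 0, .halt, .const 0 1, .halt,
    .load 27 0, .load 11 1, .jmp 113]

/-- Two consecutive words are enough even for a cell wider than a word, since its value is below `2
^ w`. The bound on `reg 20 * q` keeps the bit address from wrapping around. -/
theorem reaches_readCell {P : Program} {w Z q pc : ℕ} {mem reg : ℕ → ℕ} {rest : List Instr}
    (hP : P.drop pc = readCell ++ rest) (hmem : ∀ k, mem k = Z / 2 ^ (k * w) % 2 ^ w)
    (hw : 1 < w) (h2 : reg 2 = w) (h3 : reg 3 = 1) (h5 : reg 5 = q)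
    (h6 : reg 6 = (2 ^ q % 2 ^ w + 2 ^ w - 1) % 2 ^ w) (hc : reg 20 * q < 2 ^ w)
    (hcell : Z / 2 ^ (reg 20 * q) % 2 ^ q < 2 ^ w) :
    ∃ reg', Reaches P w mem 11 ⟨pc, reg⟩ ⟨pc + 11, reg'⟩ ∧
      reg' 21 = Z / 2 ^ (reg 20 * q) % 2 ^ q ∧ ∀ i, i < 21 ∨ 23 < i → reg' i = reg i := by
  refine ⟨_, Reaches.straight readCell rest (by simp [readCell, Instr.Straight]) hP, ?_, ?_⟩
  · have hww : w < 2 ^ w := Nat.lt_two_pow_self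
    set p := reg 20 * q with hp
    have e1 : p / w % 2 ^ w = p / w := Nat.mod_eq_of_lt ((Nat.div_le_self _ _).trans_lt hc)
    have e2 : p % w < w := Nat.mod_lt _ (by omega)
    have e3 : p % w % 2 ^ w = p % w := Nat.mod_eq_of_lt (e2.trans hww)
    have e4 : (p / w + 1) % 2 ^ w = p / w + 1 := by
      refine Nat.mod_eq_of_lt ?_
      have : p / w ≤ p / 2 := Nat.div_le_div_left hw (by norm_num)
      have : 4 ≤ 2 ^ w := Nat.pow_le_pow_right (n := 2) (by norm_num) hw
      omega
    have e5 : (w + 2 ^ w - p % w) % 2 ^ w = w - p % w := by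
      rw [show w + 2 ^ w - p % w = (w - p % w) + 2 ^ w by omega, Nat.add_mod_right,
        Nat.mod_eq_of_lt (by omega)]
    have key := straddling_read Z w p q (by omega) hcell
    have hpm : p % 2 ^ w = p := Nat.mod_eq_of_lt hc
    have hlt : ∀ k, mem k < 2 ^ w := fun k => by rw [hmem]; exact Nat.mod_lt _ (by positivity)
    have e6 : ∀ k s, mem k / 2 ^ s % 2 ^ w = mem k / 2 ^ s := fun k s =>
      Nat.mod_eq_of_lt ((Nat.div_le_self _ _).trans_lt (hlt k))
    have e7 : ∀ k, mem k % 2 ^ w = mem k := fun k => Nat.mod_eq_of_lt (hlt k)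
    have e8 : ∀ k s x, (mem k / 2 ^ s ||| x % 2 ^ w) % 2 ^ w = (mem k / 2 ^ s ||| x % 2 ^ w) :=
      fun k s x => Nat.mod_eq_of_lt (Nat.or_lt_two_pow
        ((Nat.div_le_self _ _).trans_lt (hlt k)) (Nat.mod_lt _ (by positivity)))
    simp only [runRegs, readCell, List.foldl, Instr.exec, Config.put, Function.update_apply,
      Nat.reduceEqDiff, if_true, if_false, h2, h3, h5, h6, ← hp, Nat.shiftRight_eq_div_pow,
      Nat.shiftLeft_eq, hpm, e1, e3, e4, e5, e6, e7, e8]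
    rw [hmem, hmem, key, Nat.mod_eq_of_lt hcell]
  · intro i hi
    have h21 : i ≠ 21 := by omega
    have h22 : i ≠ 22 := by omega
    have h23 : i ≠ 23 := by omega
    simp [runRegs, readCell, Instr.exec, Config.put, h21, h22, h23]

/-! ### Scanning a block -/

/-- Find the size of the class and the rank in the classes of that size, for the element of rank `r`
in a block with the sizes `base + δ` of multiplicities `μ`, for `(δ, μ)` in a list; the ranks beyond
this list belong to classes of size `base`. -/
def scan (base : ℕ) : List (ℕ × ℕ) → ℕ → ℕ × ℕ
  | [], r => (base, r)
  | e :: es, r =>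
    if r < (base + e.1) * e.2 then (base + e.1, r) else scan base es (r - (base + e.1) * e.2)

/-- A list of pairs of `j`-bit numbers as one number. -/
def pairCode (j : ℕ) : List (ℕ × ℕ) → ℕ
  | [] => 0
  | e :: es => e.1 + 2 ^ j * (e.2 + 2 ^ j * pairCode j es)

/-- No length is stored with the entries. Multiplicities are positive, so the code of the remaining
entries is zero exactly when none are left, and this ends the loop. -/
theorem reaches_scan {w j n base : ℕ} {mem : ℕ → ℕ} (hn : n < 2 ^ w) :
    ∀ (es : List (ℕ × ℕ)) (reg : ℕ → ℕ),
      (∀ e ∈ es, e.1 < 2 ^ j ∧ 0 < e.2 ∧ e.2 < 2 ^ j ∧ (base + e.1) * e.2 ≤ n) →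
      pairCode j es < 2 ^ w → 2 ^ j ≤ 2 ^ w → base ≤ n →
      reg 4 = j → reg 7 = 2 ^ j - 1 → reg 21 = pairCode j es → reg 26 = base →
      reg 24 < 2 ^ w →
      ∃ reg', Reaches queryProgram w mem (10 * es.length + 10) ⟨95, reg⟩ ⟨106, reg'⟩ ∧
        (reg' 27, reg' 24) = scan base es (reg 24) ∧ ∀ i < 20, reg' i = reg i := by
  intro es
  induction es with
  | nil =>
    intro reg _ _ _ hb h4 h7 h21 h26 hr
    have s1 : Reaches queryProgram w mem 1 ⟨95, reg⟩ _ := Reaches.jz (a := 21) (l := 105) rfl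
    rw [h21, if_pos (by rfl)] at s1
    have s2 : Reaches queryProgram w mem 1 ⟨105, reg⟩ _ :=
      Reaches.straight [.copy 27 26] _ (by simp [Instr.Straight]) rfl
    refine ⟨_, (s1.trans s2).mono (by simp), ?_, ?_⟩
    · simp [runRegs, Instr.exec, Config.put, scan, h26, Nat.mod_eq_of_lt (hb.trans_lt hn)]
    · intro i hi
      have : i ≠ 27 := by omega
      simp [runRegs, Instr.exec, Config.put, this]
  | cons e es ih =>
    intro reg he hcode hjw hb h4 h7 h21 h26 hr
    obtain ⟨hd, hm, hm', hl⟩ := he e (by simp)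
    have hj : 0 < 2 ^ j := by positivity
    have hE : pairCode j (e :: es) = e.1 + 2 ^ j * (e.2 + 2 ^ j * pairCode j es) := rfl
    have hpos : pairCode j (e :: es) ≠ 0 := by rw [hE]; positivity
    have s1 : Reaches queryProgram w mem 1 ⟨95, reg⟩ _ := Reaches.jz (a := 21) (l := 105) rfl
    rw [h21, if_neg hpos] at s1
    have s2 : Reaches queryProgram w mem 6 ⟨96, reg⟩ _ :=
      Reaches.straight [.and 27 21 7, .add 27 27 26, .shr 21 21 4, .and 28 21 7, .shr 21 21 4,
        .mul 28 28 27] _ (by simp [Instr.Straight]) rfl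
    generalize hreg1 : runRegs w mem _ reg = reg1 at s2
    have q1 : pairCode j (e :: es) % 2 ^ j = e.1 := by
      rw [hE, Nat.add_mul_mod_self_left, Nat.mod_eq_of_lt hd]
    have q2 : pairCode j (e :: es) / 2 ^ j = e.2 + 2 ^ j * pairCode j es := by
      rw [hE, Nat.add_mul_div_left _ _ hj, Nat.div_eq_of_lt hd, Nat.zero_add]
    have q3 : (e.2 + 2 ^ j * pairCode j es) % 2 ^ j = e.2 := by
      rw [Nat.add_mul_mod_self_left, Nat.mod_eq_of_lt hm']
    have q4 : (e.2 + 2 ^ j * pairCode j es) / 2 ^ j = pairCode j es := by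
      rw [Nat.add_mul_div_left _ _ hj, Nat.div_eq_of_lt hm', Nat.zero_add]
    have b1 : e.2 + 2 ^ j * pairCode j es < 2 ^ w := by
      rw [← q2]; exact (Nat.div_le_self _ _).trans_lt hcode
    have b2 : pairCode j es < 2 ^ w := by
      rw [← q4]; exact (Nat.div_le_self _ _).trans_lt b1
    have b3 : base + e.1 < 2 ^ w :=
      ((Nat.le_mul_of_pos_right _ hm).trans hl).trans_lt hn
    have b4 : e.1 < 2 ^ w := by omega
    have b5 : e.2 < 2 ^ w := by omega
    have r27 : reg1 27 = base + e.1 := by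
      rw [← hreg1]
      simp [runRegs, Instr.exec, Config.put, h4, h7, h21, h26, q1,
        Nat.mod_eq_of_lt b4, add_comm e.1, Nat.mod_eq_of_lt b3]
    have r28 : reg1 28 = (base + e.1) * e.2 := by
      rw [← hreg1]
      simp [runRegs, Instr.exec, Config.put, h4, h7, h21, h26, q1, q2, q3,
        Nat.shiftRight_eq_div_pow, Nat.mod_eq_of_lt b1, Nat.mod_eq_of_lt b5,
        Nat.mod_eq_of_lt b4, add_comm e.1, Nat.mod_eq_of_lt b3, mul_comm e.2,
        Nat.mod_eq_of_lt (hl.trans_lt hn)]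
    have r21 : reg1 21 = pairCode j es := by
      rw [← hreg1]
      simp [runRegs, Instr.exec, Config.put, h4, h21, q2, q4,
        Nat.shiftRight_eq_div_pow, Nat.mod_eq_of_lt b1, Nat.mod_eq_of_lt b2]
    have rf : ∀ i, i ≠ 21 → i ≠ 27 → i ≠ 28 → reg1 i = reg i := by
      intro i i1 i2 i3
      rw [← hreg1]
      simp [runRegs, Instr.exec, Config.put, i1, i2, i3]
    clear hreg1
    have s3 : Reaches queryProgram w mem 1 ⟨102, reg1⟩ _ :=
      Reaches.jlt (a := 24) (b := 28) (l := 106) rfl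
    rw [r28, rf 24 (by norm_num) (by norm_num) (by norm_num)] at s3
    by_cases hlt : reg 24 < (base + e.1) * e.2
    · rw [if_pos hlt] at s3
      refine ⟨reg1, ((s1.trans s2).trans s3).mono (by simp), ?_, fun i hi =>
        rf i (by omega) (by omega) (by omega)⟩
      simp [scan, hlt, r27, rf 24 (by norm_num) (by norm_num) (by norm_num)]
    · rw [if_neg hlt] at s3
      have s4 : Reaches queryProgram w mem 1 ⟨103, reg1⟩ _ :=
        Reaches.straight [.sub 24 24 28] _ (by simp [Instr.Straight]) rfl
      generalize hreg2 : runRegs w mem _ reg1 = reg2 at s4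
      have t24 : reg2 24 = reg 24 - (base + e.1) * e.2 := by
        rw [← hreg2]
        simp only [runRegs, List.foldl, Instr.exec, Config.put, Function.update_self, r28,
          rf 24 (by norm_num) (by norm_num) (by norm_num)]
        rw [show reg 24 + 2 ^ w - (base + e.1) * e.2 =
          (reg 24 - (base + e.1) * e.2) + 2 ^ w by omega, Nat.add_mod_right,
          Nat.mod_eq_of_lt (by omega)]
      have tf : ∀ i, i ≠ 24 → reg2 i = reg1 i := by
        intro i hi
        rw [← hreg2]
        simp [runRegs, Instr.exec, Config.put, hi]
      clear hreg2
      have s5 : Reaches queryProgram w mem 1 ⟨104, reg2⟩ _ := Reaches.jmp (l := 95) rfl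
      obtain ⟨reg', hR, hres, hfr⟩ := ih reg2 (fun e he' => he e (by simp [he'])) b2 hjw hb
        (by rw [tf _ (by norm_num), rf _ (by norm_num) (by norm_num) (by norm_num), h4])
        (by rw [tf _ (by norm_num), rf _ (by norm_num) (by norm_num) (by norm_num), h7])
        (by rw [tf _ (by norm_num), r21])
        (by rw [tf _ (by norm_num), rf _ (by norm_num) (by norm_num) (by norm_num), h26])
        (by rw [t24]; omega)
      refine ⟨reg', (((((s1.trans s2).trans s3).trans s4).trans s5).trans hR).mono
        (by simp; omega), ?_, fun i hi => ?_⟩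
      · rw [hres, t24]; simp [scan, hlt]
      · rw [hfr i hi, tf i (by omega), rf i (by omega) (by omega) (by omega)]

/-! ### Decoding one label -/

/-- The contents of the registers that are set up once by the query program. -/
structure Globals (w j W : ℕ) (reg : ℕ → ℕ) : Prop where
  r2 : reg 2 = w
  r3 : reg 3 = 1
  r4 : reg 4 = j
  r5 : reg 5 = 2 ^ j
  r6 : reg 6 = (2 ^ 2 ^ j % 2 ^ w + 2 ^ w - 1) % 2 ^ w
  r7 : reg 7 = 2 ^ j - 1
  r8 : reg 8 = W
  r9 : reg 9 = 0

theorem Globals.of_frame {w j W : ℕ} {reg reg' : ℕ → ℕ} (h : Globals w j W reg)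
    (hf : ∀ i, 2 ≤ i → i < 10 → reg' i = reg i) : Globals w j W reg' := by
  obtain ⟨h2, h3, h4, h5, h6, h7, h8, h9⟩ := h
  constructor <;> rw [hf _ (by norm_num) (by norm_num)] <;> assumption

/-- A memory that holds cells of `2 ^ j` bits, which are numbers of at most `w` bits; the cells with
index up to `M` can be addressed by `w`-bit words. -/
structure HasCells (w j M : ℕ) (cell mem : ℕ → ℕ) : Prop where
  one_lt : 1 < w
  two_pow_lt : 2 ^ j < 2 ^ w
  read : ∃ Z, (∀ k, mem k = Z / 2 ^ (k * w) % 2 ^ w) ∧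
    ∀ c, cell c = Z / 2 ^ (c * 2 ^ j) % 2 ^ 2 ^ j
  cell_lt : ∀ c, cell c < 2 ^ w
  addr_lt : M * 2 ^ j < 2 ^ w

theorem HasCells.le_lt {w j M c : ℕ} {cell mem : ℕ → ℕ} (h : HasCells w j M cell mem)
    (hc : c ≤ M) : c < 2 ^ w :=
  (hc.trans (Nat.le_mul_of_pos_right _ (by positivity))).trans_lt h.addr_lt

theorem HasCells.reaches {P : Program} {w j M W pc : ℕ} {cell mem reg : ℕ → ℕ}
    {rest : List Instr} (h : HasCells w j M cell mem) (hP : P.drop pc = readCell ++ rest)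
    (hg : Globals w j W reg) (hc : reg 20 ≤ M) :
    ∃ reg', Reaches P w mem 11 ⟨pc, reg⟩ ⟨pc + 11, reg'⟩ ∧
      reg' 21 = cell (reg 20) ∧ Globals w j W reg' ∧ ∀ i, i < 21 ∨ 23 < i → reg' i = reg i := by
  obtain ⟨Z, hmem, hcell⟩ := h.read
  obtain ⟨reg', hR, h1, h2⟩ := reaches_readCell hP hmem h.one_lt hg.r2 hg.r3 hg.r5 hg.r6
    ((Nat.mul_le_mul_right _ hc).trans_lt h.addr_lt) (by rw [← hcell]; exact h.cell_lt _)
  exact ⟨reg', hR, by rw [h1, hcell], hg.of_frame fun i _ _ => h2 i (by omega), h2⟩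

/-- Two header cells come first, and every bucket occupies six cells; this is the address arithmetic
for the bucket of label `x + 1`. -/
theorem reaches_cut {w j M W x : ℕ} {cell mem reg : ℕ → ℕ} (h : HasCells w j M cell mem)
    (hg : Globals w j W reg) (hx : reg 0 = x + 1) (hxw : x + 1 < 2 ^ w)
    (hw : 3 ≤ w) (hM : 2 + 6 * (x / W) ≤ M) :
    ∃ reg', Reaches queryProgram w mem 18 ⟨34, reg⟩ ⟨52, reg'⟩ ∧ Globals w j W reg' ∧
      reg' 20 = 2 + 6 * (x / W) ∧ reg' 21 = cell (2 + 6 * (x / W)) ∧ reg' 24 = x % W ∧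
      ∀ i < 20, reg' i = reg i := by
  have s1 : Reaches queryProgram w mem 7 ⟨34, reg⟩ _ :=
    Reaches.straight [.sub 25 0 3, .mod 24 25 8, .div 20 25 8, .const 25 6, .mul 20 20 25,
      .const 25 2, .add 20 20 25] _ (by simp [Instr.Straight]) rfl
  generalize hreg1 : runRegs w mem _ reg = reg1 at s1
  have h8 : 2 ^ 3 ≤ 2 ^ w := Nat.pow_le_pow_right (by norm_num) hw
  have hMw := h.le_lt hM
  have e1 : x % 2 ^ w = x := Nat.mod_eq_of_lt (by omega)
  have e2 : x % W % 2 ^ w = x % W := Nat.mod_eq_of_lt ((Nat.mod_le _ _).trans_lt (by omega))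
  have e3 : x / W % 2 ^ w = x / W := Nat.mod_eq_of_lt (by omega)
  have e4 : 6 % 2 ^ w = 6 := Nat.mod_eq_of_lt (by omega)
  have e5 : 2 % 2 ^ w = 2 := Nat.mod_eq_of_lt (by omega)
  have e7 : (x / W * 6 + 2) % 2 ^ w = 2 + 6 * (x / W) := by
    rw [Nat.mod_eq_of_lt (by omega)]; ring
  have r24 : reg1 24 = x % W := by
    rw [← hreg1]
    simp [runRegs, Instr.exec, Config.put, hx, hg.r3, hg.r8, e1, e2]
  have r20 : reg1 20 = 2 + 6 * (x / W) := by
    rw [← hreg1]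
    simp [runRegs, Instr.exec, Config.put, hx, hg.r3, hg.r8, e1, e3, e4, e5, e7]
  have rf : ∀ i < 20, reg1 i = reg i := by
    intro i hi
    have i1 : i ≠ 20 := by omega
    have i2 : i ≠ 24 := by omega
    have i3 : i ≠ 25 := by omega
    rw [← hreg1]
    simp [runRegs, Instr.exec, Config.put, i1, i2, i3]
  clear hreg1
  obtain ⟨reg2, s2, t21, hg2, tf⟩ := h.reaches (P := queryProgram) (pc := 41) (rest := _) rfl
    (hg.of_frame fun i _ hi => rf i (by omega)) (r20.trans_le hM)
  refine ⟨reg2, s1.trans s2, hg2, ?_, ?_, ?_, fun i hi => ?_⟩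
  · rw [tf _ (by norm_num), r20]
  · rw [t21, r20]
  · rw [tf _ (by norm_num), r24]
  · rw [tf _ (by omega), rf _ hi]

/-- A bucket starting at cell `c` holds the cut, the offset, and then two blocks of two cells each.
Positions before the cut belong to the first block, shifted by the offset; the others belong to the
second block and count from 0. -/
theorem reaches_piece {w j M W p c b r : ℕ} {cell mem reg : ℕ → ℕ} (h : HasCells w j M cell mem)
    (hg : Globals w j W reg) (hw : 3 ≤ w) (hc : c + 6 ≤ M) (hpw : p < 2 ^ w) (hr : r < 2 ^ w)
    (h20 : reg 20 = c) (h21 : reg 21 = cell c) (h24 : reg 24 = p)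
    (hb : p < cell c ∧ r = p + cell (c + 1) ∧ b = c + 2 ∨
      cell c ≤ p ∧ r = p - cell c ∧ b = c + 4) :
    ∃ reg', Reaches queryProgram w mem 20 ⟨52, reg⟩ ⟨71, reg'⟩ ∧ Globals w j W reg' ∧
      reg' 20 = b ∧ reg' 24 = r ∧ ∀ i < 20, reg' i = reg i := by
  have h8 : 2 ^ 3 ≤ 2 ^ w := Nat.pow_le_pow_right (by norm_num) hw
  have hMw := h.le_lt hc
  have s1 : Reaches queryProgram w mem 1 ⟨52, reg⟩ _ :=
    Reaches.jlt (a := 24) (b := 21) (l := 57) rfl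
  rw [h21, h24] at s1
  rcases hb with ⟨hlt, rfl, rfl⟩ | ⟨hle, rfl, rfl⟩
  · rw [if_pos hlt] at s1
    have s2 : Reaches queryProgram w mem 1 ⟨57, reg⟩ _ :=
      Reaches.straight [.add 20 20 3] _ (by simp [Instr.Straight]) rfl
    generalize hreg1 : runRegs w mem _ reg = reg1 at s2
    have r20 : reg1 20 = c + 1 := by
      rw [← hreg1]
      simp [runRegs, Instr.exec, Config.put, h20, hg.r3, Nat.mod_eq_of_lt (show c + 1 < 2 ^ w by omega)]
    have rf : ∀ i, i ≠ 20 → reg1 i = reg i := by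
      intro i hi
      rw [← hreg1]
      simp [runRegs, Instr.exec, Config.put, hi]
    clear hreg1
    have hg1 := hg.of_frame fun i _ hi => rf i (by omega)
    obtain ⟨reg2, s3, t21, hg2, tf⟩ := h.reaches (P := queryProgram) (pc := 58) (rest := _) rfl
      hg1 (by omega)
    have s4 : Reaches queryProgram w mem 2 ⟨69, reg2⟩ _ :=
      Reaches.straight [.add 24 24 21, .add 20 20 3] _ (by simp [Instr.Straight]) rfl
    have t24 : reg2 24 = p := by rw [tf _ (by norm_num), rf _ (by norm_num), h24]
    have t20 : reg2 20 = c + 1 := by rw [tf _ (by norm_num), r20]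
    have hff : ∀ i < 20, runRegs w mem [.add 24 24 21, .add 20 20 3] reg2 i = reg i := by
      intro i hi
      have i1 : i ≠ 20 := by omega
      have i2 : i ≠ 24 := by omega
      rw [← rf i (by omega), ← tf i (by omega)]
      simp [runRegs, Instr.exec, Config.put, i1, i2]
    refine ⟨_, (((s1.trans s2).trans s3).trans s4).mono (by norm_num),
      hg.of_frame fun i _ hi => hff i (by omega), ?_, ?_, hff⟩
    · simp [runRegs, Instr.exec, Config.put, t20, hg2.r3,
        Nat.mod_eq_of_lt (show c + 2 < 2 ^ w by omega)]
    · simp [runRegs, Instr.exec, Config.put, t24, t21, r20, Nat.mod_eq_of_lt hr]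
  · rw [if_neg (by omega)] at s1
    have s2 : Reaches queryProgram w mem 3 ⟨53, reg⟩ _ :=
      Reaches.straight [.sub 24 24 21, .const 25 4, .add 20 20 25] _ (by simp [Instr.Straight]) rfl
    have s3 := s2.trans (Reaches.jmp (l := 71) rfl)
    have hff : ∀ i < 20, runRegs w mem [.sub 24 24 21, .const 25 4, .add 20 20 25] reg i = reg i := by
      intro i hi
      have i1 : i ≠ 20 := by omega
      have i2 : i ≠ 24 := by omega
      have i3 : i ≠ 25 := by omega
      simp [runRegs, Instr.exec, Config.put, i1, i2, i3]
    refine ⟨_, (s1.trans s3).mono (by norm_num),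
      hg.of_frame fun i _ hi => hff i (by omega), ?_, ?_, hff⟩
    · simp [runRegs, Instr.exec, Config.put, h20, Nat.mod_eq_of_lt (show 4 < 2 ^ w by omega),
        Nat.mod_eq_of_lt (show c + 4 < 2 ^ w by omega)]
    · simp only [runRegs, List.foldl, Instr.exec, Config.put, Function.update_apply,
        Nat.reduceEqDiff, if_true, if_false, h24, h21]
      rw [show p + 2 ^ w - cell c = (p - cell c) + 2 ^ w by omega, Nat.add_mod_right,
        Nat.mod_eq_of_lt (by omega)]

theorem reaches_class {w j n M W b s u : ℕ} {es : List (ℕ × ℕ)} {cell mem reg : ℕ → ℕ}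
    (h : HasCells w j M cell mem) (hn : n < 2 ^ w)
    (hg : Globals w j W reg) (hb : b + 1 ≤ M)
    (h20 : reg 20 = b) (hr : reg 24 < 2 ^ w) (hbase : cell b ≤ n)
    (hes : cell (b + 1) = pairCode j es)
    (hval : ∀ e ∈ es, e.1 < 2 ^ j ∧ 0 < e.2 ∧ e.2 < 2 ^ j ∧ (cell b + e.1) * e.2 ≤ n)
    (hscan : scan (cell b) es (reg 24) = (s, u)) (hu : u < 2 ^ w) :
    ∃ reg', Reaches queryProgram w mem (10 * es.length + 50) ⟨71, reg⟩ ⟨107, reg'⟩ ∧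
      reg' 27 = s ∧ reg' 24 = u / s ∧ ∀ i < 20, reg' i = reg i := by
  have hMw := h.le_lt hb
  obtain ⟨reg1, s1, r21, hg1, rf⟩ := h.reaches (P := queryProgram) (pc := 71) (rest := _) rfl
    hg (by omega)
  have s2 : Reaches queryProgram w mem 2 ⟨82, reg1⟩ _ :=
    Reaches.straight [.copy 26 21, .add 20 20 3] _ (by simp [Instr.Straight]) rfl
  generalize hreg2 : runRegs w mem _ reg1 = reg2 at s2
  have t26 : reg2 26 = cell b := by
    rw [← hreg2]
    simp [runRegs, Instr.exec, Config.put, r21, h20, Nat.mod_eq_of_lt (h.cell_lt b)]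
  have t20 : reg2 20 = b + 1 := by
    rw [← hreg2]
    simp [runRegs, Instr.exec, Config.put, rf 20 (by norm_num), h20, hg1.r3,
      Nat.mod_eq_of_lt hMw]
  have tf : ∀ i, i ≠ 20 → i ≠ 26 → reg2 i = reg1 i := by
    intro i i1 i2
    rw [← hreg2]
    simp [runRegs, Instr.exec, Config.put, i1, i2]
  clear hreg2
  have hg2 := hg1.of_frame fun i _ hi => tf i (by omega) (by omega)
  obtain ⟨reg3, s3, u21, hg3, uf⟩ := h.reaches (P := queryProgram) (pc := 84) (rest := _) rfl
    hg2 (by omega)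
  rw [t20, hes] at u21
  have u24 : reg3 24 = reg 24 := by
    rw [uf _ (by norm_num), tf _ (by norm_num) (by norm_num), rf _ (by norm_num)]
  obtain ⟨reg4, s4, v, vf⟩ := reaches_scan (mem := mem) hn es reg3 hval
    (by rw [← hes]; exact h.cell_lt _) h.two_pow_lt.le hbase hg3.r4 hg3.r7 u21
    (by rw [uf _ (by norm_num), t26]) (by rw [u24]; exact hr)
  rw [u24, hscan, Prod.mk.injEq] at v
  have s5 : Reaches queryProgram w mem 1 ⟨106, reg4⟩ _ :=
    Reaches.straight [.div 24 24 27] _ (by simp [Instr.Straight]) rfl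
  refine ⟨_, ((((s1.trans s2).trans s3).trans s4).trans s5).mono (by simp; omega), ?_, ?_,
    fun i hi => ?_⟩
  · simp [runRegs, Instr.exec, Config.put, v.1]
  · simp [runRegs, Instr.exec, Config.put, v.1, v.2,
      Nat.mod_eq_of_lt ((Nat.div_le_self u s).trans_lt hu)]
  · rw [← rf i (by omega), ← tf i (by omega) (by omega), ← uf i (by omega), ← vf i hi]
    have i1 : i ≠ 24 := by omega
    simp [runRegs, Instr.exec, Config.put, i1]

/-! ### The final comparison and the start of a query -/

theorem xor_or_xor_eq_zero (a b c d : ℕ) : (a ^^^ b ||| c ^^^ d) = 0 ↔ a = b ∧ c = d := by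
  rw [Nat.or_eq_zero_iff, Nat.xor_eq_zero_iff, Nat.xor_eq_zero_iff]

theorem reaches_compare {w : ℕ} {mem reg : ℕ → ℕ} (hw : 0 < w) (h27 : reg 27 < 2 ^ w)
    (h11 : reg 11 < 2 ^ w) (h24 : reg 24 < 2 ^ w) (h12 : reg 12 < 2 ^ w) :
    ∃ c, Reaches queryProgram w mem 10 ⟨113, reg⟩ c ∧ queryProgram.at c.pc = .halt ∧
      c.reg 0 = if reg 27 = reg 11 ∧ reg 24 = reg 12 then 1 else 0 := by
  have s1 : Reaches queryProgram w mem 3 ⟨113, reg⟩ _ :=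
    Reaches.straight [.xor 27 27 11, .xor 24 24 12, .or 27 27 24] _
      (by simp [Instr.Straight]) rfl
  generalize hreg1 : runRegs w mem _ reg = reg1 at s1
  have r27 : reg1 27 = 0 ↔ reg 27 = reg 11 ∧ reg 24 = reg 12 := by
    rw [← xor_or_xor_eq_zero, ← hreg1]
    simp only [runRegs, List.foldl, Instr.exec, Config.put, Function.update_apply,
      Nat.reduceEqDiff, if_true, if_false]
    rw [Nat.mod_eq_of_lt (Nat.xor_lt_two_pow h27 h11), Nat.mod_eq_of_lt (Nat.xor_lt_two_pow h24 h12),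
      Nat.mod_eq_of_lt (Nat.or_lt_two_pow (Nat.xor_lt_two_pow h27 h11)
        (Nat.xor_lt_two_pow h24 h12))]
  have s2 : Reaches queryProgram w mem 1 ⟨116, reg1⟩ _ := Reaches.jz (a := 27) (l := 119) rfl
  have h1 : 1 < 2 ^ w := Nat.one_lt_two_pow hw.ne'
  by_cases h : reg 27 = reg 11 ∧ reg 24 = reg 12
  · rw [if_pos (r27.2 h)] at s2
    have s3 : Reaches queryProgram w mem 1 ⟨119, reg1⟩ _ :=
      Reaches.straight [.const 0 1] _ (by simp [Instr.Straight]) rfl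
    refine ⟨_, ((s1.trans s2).trans s3).mono (by norm_num), rfl, ?_⟩
    rw [if_pos h]
    simp [runRegs, Instr.exec, Config.put, Nat.mod_eq_of_lt h1]
  · rw [if_neg (mt r27.1 h)] at s2
    have s3 : Reaches queryProgram w mem 1 ⟨117, reg1⟩ _ :=
      Reaches.straight [.const 0 0] _ (by simp [Instr.Straight]) rfl
    refine ⟨_, ((s1.trans s2).trans s3).mono (by norm_num), rfl, ?_⟩
    rw [if_neg h]
    simp [runRegs, Instr.exec, Config.put]

/-- Shifting right eight times leaves `w / 256`, which is zero exactly for `w < 256`. -/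
theorem reaches_word_size_test {w x y : ℕ} {mem : ℕ → ℕ} (hw : 2 ≤ w) :
    ∃ reg, Reaches queryProgram w mem 11 (init w x y)
        ⟨if w < 256 then 121 else 11, reg⟩ ∧ reg 3 = 1 ∧
      ∀ i, i ≠ 3 → i ≠ 21 → reg i = (init w x y).reg i := by
  have s1 : Reaches queryProgram w mem 10 ⟨0, (init w x y).reg⟩ _ :=
    Reaches.straight [.const 3 1, .copy 21 2, .shr 21 21 3, .shr 21 21 3, .shr 21 21 3,
      .shr 21 21 3, .shr 21 21 3, .shr 21 21 3, .shr 21 21 3, .shr 21 21 3] _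
      (by simp [Instr.Straight]) rfl
  generalize hreg1 : runRegs w mem _ _ = reg1 at s1
  have h1 : 1 < 2 ^ w := Nat.one_lt_two_pow (by omega)
  have hd : ∀ k, w / k % 2 ^ w = w / k := fun k =>
    Nat.mod_eq_of_lt ((Nat.div_le_self _ _).trans_lt Nat.lt_two_pow_self)
  have hd1 : w % 2 ^ w = w := Nat.mod_eq_of_lt Nat.lt_two_pow_self
  have r21 : reg1 21 = w / 256 := by
    rw [← hreg1]
    simp [runRegs, Instr.exec, Config.put, init, Nat.shiftRight_eq_div_pow, Nat.mod_eq_of_lt h1,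
      Nat.div_div_eq_div_mul, hd, hd1]
  have s2 : Reaches queryProgram w mem 1 ⟨10, reg1⟩ _ := Reaches.jz (a := 21) (l := 121) rfl
  have h0 : (reg1 21 = 0) = (w < 256) := by
    rw [r21]; simp [Nat.div_eq_zero_iff]
  simp only [h0] at s2
  refine ⟨reg1, s1.trans s2, ?_, ?_⟩
  · rw [← hreg1]
    simp [runRegs, Instr.exec, Config.put, Nat.mod_eq_of_lt h1]
  · intro i i1 i2
    rw [← hreg1]
    simp [runRegs, Instr.exec, Config.put, i1, i2]

/-- On a machine with small words, the memory is used as an array. -/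
theorem reaches_array {w x y : ℕ} {mem : ℕ → ℕ} (hw : 2 ≤ w) (hw' : w < 256)
    (hmem : ∀ k, mem k < 2 ^ w) :
    ∃ c, Reaches queryProgram w mem 30 (init w x y) c ∧ queryProgram.at c.pc = .halt ∧
      c.reg 0 = if mem x = mem y then 1 else 0 := by
  obtain ⟨reg, s1, -, rf⟩ := reaches_word_size_test (x := x) (y := y) (mem := mem) hw
  rw [if_pos hw'] at s1
  have s2 : Reaches queryProgram w mem 2 ⟨121, reg⟩ _ :=
    Reaches.straight [.load 27 0, .load 11 1] _ (by simp [Instr.Straight]) rfl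
  generalize hreg1 : runRegs w mem _ _ = reg1 at s2
  have r27 : reg1 27 = mem x := by
    rw [← hreg1]
    simp [runRegs, Instr.exec, Config.put, rf, init, Nat.mod_eq_of_lt (hmem x)]
  have r11 : reg1 11 = mem y := by
    rw [← hreg1]
    simp [runRegs, Instr.exec, Config.put, rf, init, Nat.mod_eq_of_lt (hmem y)]
  -- Registers 24 and 12 are still zero, so the comparison shared with the other branch reduces to
  -- that of registers 27 and 11.
  have r24 : reg1 24 = 0 := by
    rw [← hreg1]
    simp [runRegs, Instr.exec, Config.put, rf, init]
  have r12 : reg1 12 = 0 := by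
    rw [← hreg1]
    simp [runRegs, Instr.exec, Config.put, rf, init]
  clear hreg1
  have s3 : Reaches queryProgram w mem 1 ⟨123, reg1⟩ _ := Reaches.jmp (l := 113) rfl
  obtain ⟨c, s4, h1, h2⟩ := reaches_compare (w := w) (mem := mem) (reg := reg1) (by omega)
    (by rw [r27]; exact hmem _) (by rw [r11]; exact hmem _) (by rw [r24]; positivity)
    (by rw [r12]; positivity)
  refine ⟨c, (((s1.trans s2).trans s3).trans s4).mono (by norm_num), h1, ?_⟩
  simpa [r27, r11, r24, r12] using h2

/-- The word need only agree with `2 ^ d` in its lowest `d + 1` bits, so the count can be made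
before the width of a cell is known. Each round costs five steps. -/
theorem reaches_trailing_zeros {w : ℕ} {mem : ℕ → ℕ} (hw : 0 < w) :
    ∀ (d : ℕ) (reg : ℕ → ℕ), reg 3 = 1 → reg 9 = 0 → reg 21 < 2 ^ w →
      reg 21 % 2 ^ (d + 1) = 2 ^ d → reg 4 + d < 2 ^ w →
      ∃ reg', Reaches queryProgram w mem (5 * d + 2) ⟨12, reg⟩ ⟨17, reg'⟩ ∧
        reg' 4 = reg 4 + d ∧ ∀ i, i ≠ 4 → i ≠ 21 → i ≠ 22 → reg' i = reg i := by
  intro d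
  induction d with
  | zero =>
    intro reg h3 h9 h21 hv hb
    have s1 : Reaches queryProgram w mem 1 ⟨12, reg⟩ _ :=
      Reaches.straight [.and 22 21 3] _ (by simp [Instr.Straight]) rfl
    generalize hreg1 : runRegs w mem _ _ = reg1 at s1
    have rf : ∀ i, i ≠ 22 → reg1 i = reg i := by
      intro i hi
      rw [← hreg1]
      simp [runRegs, Instr.exec, Config.put, hi]
    have r22 : reg1 22 = 1 := by
      rw [← hreg1]
      have : reg 21 % 2 = 1 := by simpa using hv
      simp [runRegs, Instr.exec, Config.put, h3, this, Nat.mod_eq_of_lt (Nat.one_lt_two_pow hw.ne')]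
    have s2 : Reaches queryProgram w mem 1 ⟨13, reg1⟩ _ :=
      Reaches.jlt (a := 9) (b := 22) (l := 17) rfl
    rw [rf 9 (by norm_num), h9, r22, if_pos one_pos] at s2
    exact ⟨reg1, (s1.trans s2).mono (by norm_num), rf _ (by norm_num), fun i _ _ hi => rf i hi⟩
  | succ d ih =>
    intro reg h3 h9 h21 hv hb
    have s1 : Reaches queryProgram w mem 1 ⟨12, reg⟩ _ :=
      Reaches.straight [.and 22 21 3] _ (by simp [Instr.Straight]) rfl
    generalize hreg1 : runRegs w mem _ _ = reg1 at s1
    have rf : ∀ i, i ≠ 22 → reg1 i = reg i := by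
      intro i hi
      rw [← hreg1]
      simp [runRegs, Instr.exec, Config.put, hi]
    have hmod : reg 21 % 2 = 0 ∧ reg 21 / 2 % 2 ^ (d + 1) = 2 ^ d := by
      rw [pow_succ' 2 (d + 1), Nat.mod_mul] at hv
      rw [pow_succ' 2 d] at hv ⊢
      have := Nat.mod_lt (reg 21) (show 0 < 2 by norm_num)
      omega
    have r22 : reg1 22 = 0 := by
      rw [← hreg1]
      simp [runRegs, Instr.exec, Config.put, h3, hmod.1]
    have s2 : Reaches queryProgram w mem 1 ⟨13, reg1⟩ _ :=
      Reaches.jlt (a := 9) (b := 22) (l := 17) rfl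
    rw [rf 9 (by norm_num), h9, r22, if_neg (lt_irrefl _)] at s2
    have s3 : Reaches queryProgram w mem 2 ⟨14, reg1⟩ _ :=
      Reaches.straight [.shr 21 21 3, .add 4 4 3] _ (by simp [Instr.Straight]) rfl
    generalize hreg2 : runRegs w mem _ _ = reg2 at s3
    have tf : ∀ i, i ≠ 4 → i ≠ 21 → reg2 i = reg1 i := by
      intro i i1 i2
      rw [← hreg2]
      simp [runRegs, Instr.exec, Config.put, i1, i2]
    have t21 : reg2 21 = reg 21 / 2 := by
      rw [← hreg2]
      simp [runRegs, Instr.exec, Config.put, rf, h3, Nat.shiftRight_eq_div_pow,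
        Nat.mod_eq_of_lt ((Nat.div_le_self _ 2).trans_lt h21)]
    have t4 : reg2 4 = reg 4 + 1 := by
      rw [← hreg2]
      simp [runRegs, Instr.exec, Config.put, rf, h3,
        Nat.mod_eq_of_lt (show reg 4 + 1 < 2 ^ w by omega)]
    clear hreg1 hreg2
    have s4 : Reaches queryProgram w mem 1 ⟨16, reg2⟩ _ := Reaches.jmp (l := 12) rfl
    obtain ⟨reg', s5, h4, hf⟩ := ih reg2 (by simp [tf, rf, h3]) (by simp [tf, rf, h9])
      (by rw [t21]; omega) (by rw [t21]; exact hmod.2) (by rw [t4]; omega)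
    refine ⟨reg', ((((s1.trans s2).trans s3).trans s4).trans s5).mono (by omega),
      by rw [h4, t4]; ring, fun i i1 i2 i3 => ?_⟩
    rw [hf i i1 i2 i3, tf i i1 i2, rf i i3]

theorem reaches_setup {w j M W x y : ℕ} {cell mem : ℕ → ℕ} (h : HasCells w j M cell mem)
    (hw : 256 ≤ w) (hj : j < w) (hM : 1 ≤ M) (h0 : cell 0 = 2 ^ j) (h1 : cell 1 = W) :
    ∃ reg, Reaches queryProgram w mem (5 * j + 40) (init w x y) ⟨34, reg⟩ ∧ Globals w j W reg ∧
      reg 0 = x ∧ reg 1 = y ∧ reg 10 = 0 := by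
  obtain ⟨reg, s1, r3, rf⟩ := reaches_word_size_test (x := x) (y := y) (mem := mem)
    (show 2 ≤ w by omega)
  rw [if_neg (by omega)] at s1
  have s2 : Reaches queryProgram w mem 1 ⟨11, reg⟩ _ :=
    Reaches.straight [.load 21 9] _ (by simp [Instr.Straight]) rfl
  generalize hreg1 : runRegs w mem _ _ = reg1 at s2
  obtain ⟨Z, hmem, hcell⟩ := h.read
  have tf : ∀ i, i ≠ 21 → reg1 i = reg i := by
    intro i hi
    rw [← hreg1]
    simp [runRegs, Instr.exec, Config.put, hi]
  have t21 : reg1 21 = Z % 2 ^ w := by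
    rw [← hreg1]
    simp [runRegs, Instr.exec, Config.put, rf, init, hmem]
  clear hreg1
  have hjw : j < 2 ^ w := hj.trans Nat.lt_two_pow_self
  -- The lowest `j + 1` bits lie both in the first word, as `j < w`, and in the first cell, as `j +
  -- 1 ≤ 2 ^ j`; that cell contains `2 ^ j`.
  have hZ : Z % 2 ^ w % 2 ^ (j + 1) = 2 ^ j := by
    rw [Nat.mod_mod_of_dvd _ (pow_dvd_pow 2 hj)]
    have : Z % 2 ^ 2 ^ j = 2 ^ j := by
      have := hcell 0
      rw [h0] at this
      simpa using this.symm
    rw [← Nat.mod_mod_of_dvd Z (pow_dvd_pow 2 (show j + 1 ≤ 2 ^ j from Nat.lt_two_pow_self)), this]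
    exact Nat.mod_eq_of_lt (Nat.pow_lt_pow_right (by norm_num) (by omega))
  have t4 : reg1 4 = 0 := by simp [tf, rf, init]
  obtain ⟨reg2, s3, u4, uf⟩ := reaches_trailing_zeros (w := w) (mem := mem) (by omega) j reg1
    (by rw [tf _ (by norm_num), r3]) (by simp [tf, rf, init])
    (by rw [t21]; exact Nat.mod_lt _ (by positivity)) (by rw [t21]; exact hZ)
    (by rw [t4]; omega)
  rw [t4, Nat.zero_add] at u4
  have u3 : reg2 3 = 1 := by
    rw [uf _ (by norm_num) (by norm_num) (by norm_num), tf _ (by norm_num), r3]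
  have uf' : ∀ i, i ≠ 3 → i ≠ 4 → i ≠ 21 → i ≠ 22 → reg2 i = (init w x y).reg i := by
    intro i i1 i2 i3 i4
    rw [uf i i2 i3 i4, tf i i3, rf i i1 i3]
  have s4 : Reaches queryProgram w mem 5 ⟨17, reg2⟩ _ :=
    Reaches.straight [.shl 5 3 4, .shl 6 3 5, .sub 6 6 3, .sub 7 5 3, .copy 20 3] _
      (by simp [Instr.Straight]) rfl
  generalize hreg3 : runRegs w mem _ _ = reg3 at s4
  have hjj : 0 < 2 ^ j := by positivity
  have e1 := Nat.mod_eq_of_lt h.two_pow_lt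
  have e2 : (2 ^ j + 2 ^ w - 1) % 2 ^ w = 2 ^ j - 1 := by
    rw [show 2 ^ j + 2 ^ w - 1 = (2 ^ j - 1) + 2 ^ w by omega, Nat.add_mod_right]
    exact Nat.mod_eq_of_lt (by have := h.two_pow_lt; omega)
  have hone : 1 % 2 ^ w = 1 := Nat.mod_eq_of_lt (Nat.one_lt_two_pow (by omega))
  have v20 : reg3 20 = 1 := by
    rw [← hreg3]
    simp [runRegs, Instr.exec, Config.put, u3, hone]
  have vf : ∀ i, i ≠ 5 → i ≠ 6 → i ≠ 7 → i ≠ 20 → reg3 i = reg2 i := by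
    intro i i1 i2 i3 i4
    rw [← hreg3]
    simp [runRegs, Instr.exec, Config.put, i1, i2, i3, i4]
  have v5 : reg3 5 = 2 ^ j := by
    rw [← hreg3]
    simp [runRegs, Instr.exec, Config.put, u3, u4, Nat.shiftLeft_eq, e1]
  have v6 : reg3 6 = (2 ^ 2 ^ j % 2 ^ w + 2 ^ w - 1) % 2 ^ w := by
    rw [← hreg3]
    simp [runRegs, Instr.exec, Config.put, u3, u4, Nat.shiftLeft_eq, e1]
  have v7 : reg3 7 = 2 ^ j - 1 := by
    rw [← hreg3]
    simp [runRegs, Instr.exec, Config.put, u3, u4, Nat.shiftLeft_eq, e1, e2]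
  clear hreg3
  -- Register 8 is still zero here. The value 0 stands in for `W` until `W` has been read from cell
  -- 1.
  have hg : Globals w j 0 reg3 := by
    refine ⟨?_, ?_, ?_, v5, v6, v7, ?_, ?_⟩
    · simp [vf, uf', init]
    · simp [vf, u3]
    · simp [vf, u4]
    · simp [vf, uf', init]
    · simp [vf, uf', init]
  obtain ⟨reg4, s5, x21, hg4, xf⟩ := h.reaches (P := queryProgram) (pc := 22) (rest := _) rfl
    hg (v20.trans_le hM)
  have s6 : Reaches queryProgram w mem 1 ⟨33, reg4⟩ _ :=
    Reaches.straight [.copy 8 21] _ (by simp [Instr.Straight]) rfl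
  generalize hreg5 : runRegs w mem _ _ = reg5 at s6
  have y8 : reg5 8 = W := by
    rw [← hreg5]
    simp [runRegs, Instr.exec, Config.put, x21, v20, h1, Nat.mod_eq_of_lt (h1 ▸ h.cell_lt 1)]
  have yf : ∀ i, i ≠ 8 → reg5 i = reg4 i := by
    intro i hi
    rw [← hreg5]
    simp [runRegs, Instr.exec, Config.put, hi]
  clear hreg5
  refine ⟨reg5, (((((s1.trans s2).trans s3).trans s4).trans s5).trans s6).mono (by simp; omega),
    ?_, ?_, ?_, ?_⟩
  · obtain ⟨k2, k3, k4, k5, k6, k7, k8, k9⟩ := hg4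
    exact ⟨(yf _ (by norm_num)).trans k2, (yf _ (by norm_num)).trans k3,
      (yf _ (by norm_num)).trans k4, (yf _ (by norm_num)).trans k5, (yf _ (by norm_num)).trans k6,
      (yf _ (by norm_num)).trans k7, y8, (yf _ (by norm_num)).trans k9⟩
  · simp [yf, xf, vf, uf', init]
  · simp [yf, xf, vf, uf', init]
  · simp [yf, xf, vf, uf', init]

/-! ### A complete query -/

/-- The cells determine that the element with label `x + 1` has rank `u` among the elements in
classes of size `s`. -/
def Decodes (n j W M : ℕ) (cell : ℕ → ℕ) (x s u : ℕ) : Prop :=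
  x < n ∧ s ≤ n ∧ u ≤ n ∧ 2 + 6 * (x / W) + 6 ≤ M ∧
    ∃ (b r : ℕ) (es : List (ℕ × ℕ)), r ≤ n ∧ es.length ≤ j ∧
      (x % W < cell (2 + 6 * (x / W)) ∧ r = x % W + cell (2 + 6 * (x / W) + 1) ∧
          b = 2 + 6 * (x / W) + 2 ∨
        cell (2 + 6 * (x / W)) ≤ x % W ∧ r = x % W - cell (2 + 6 * (x / W)) ∧
          b = 2 + 6 * (x / W) + 4) ∧
      cell b ≤ n ∧ cell (b + 1) = pairCode j es ∧
      (∀ e ∈ es, e.1 < 2 ^ j ∧ 0 < e.2 ∧ e.2 < 2 ^ j ∧ (cell b + e.1) * e.2 ≤ n) ∧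
      scan (cell b) es r = (s, u)

theorem reaches_decode {w j n M W x s u : ℕ} {cell mem reg : ℕ → ℕ}
    (h : HasCells w j M cell mem) (hn : n < 2 ^ w) (hw : 3 ≤ w) (hd : Decodes n j W M cell x s u)
    (hg : Globals w j W reg) (hx : reg 0 = x + 1) :
    ∃ reg', Reaches queryProgram w mem (10 * j + 100) ⟨34, reg⟩ ⟨107, reg'⟩ ∧
      reg' 27 = s ∧ reg' 24 = u / s ∧ ∀ i < 20, reg' i = reg i := by
  obtain ⟨hxn, hs, hu, hM, b, r, es, hr, hlen, hcase, hbase, hes, hval, hscan⟩ := hd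
  obtain ⟨reg1, s1, hg1, r20, r21, r24, rf⟩ := reaches_cut h hg hx (by omega) hw (by omega)
  obtain ⟨reg2, s2, hg2, t20, t24, tf⟩ := reaches_piece h hg1 hw hM
    (((Nat.mod_le x W).trans hxn.le).trans_lt hn) (hr.trans_lt hn) r20 r21 r24 hcase
  obtain ⟨reg3, s3, v27, v24, vf⟩ := reaches_class h hn hg2 (by omega) t20
    (by rw [t24]; omega) hbase hes hval (by rw [t24]; exact hscan) (hu.trans_lt hn)
  exact ⟨reg3, ((s1.trans s2).trans s3).mono (by omega), v27, v24, fun i hi => by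
    rw [vf i hi, tf i hi, rf i hi]⟩

/-- Decoding is a subroutine used twice, and the two results are compared as pairs of a class size
and a class number. Set-up costs about `5 * j` steps and each decoding about `10 * j`. -/
theorem reaches_answer {w j n M W x y s u s' u' : ℕ} {cell mem : ℕ → ℕ}
    (h : HasCells w j M cell mem) (hw : 256 ≤ w) (hj : j < w) (hn : n < 2 ^ w)
    (h0 : cell 0 = 2 ^ j) (h1 : cell 1 = W) (hx : Decodes n j W M cell x s u)
    (hy : Decodes n j W M cell y s' u') :
    ∃ c, Reaches queryProgram w mem (25 * j + 300) (init w (x + 1) (y + 1)) c ∧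
      queryProgram.at c.pc = .halt ∧ c.reg 0 = if s = s' ∧ u / s = u' / s' then 1 else 0 := by
  have hM : 1 ≤ M := by have := hx.2.2.2.1; omega
  obtain ⟨reg, s1, hg, r0, r1, r10⟩ := reaches_setup (x := x + 1) (y := y + 1) h hw hj hM h0 h1
  obtain ⟨reg1, s2, t27, t24, tf⟩ := reaches_decode h hn (by omega) hx hg r0
  have hsw : s < 2 ^ w := hx.2.1.trans_lt hn
  have huw : u / s < 2 ^ w := ((Nat.div_le_self _ _).trans hx.2.2.1).trans_lt hn
  have hsw' : s' < 2 ^ w := hy.2.1.trans_lt hn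
  have huw' : u' / s' < 2 ^ w := ((Nat.div_le_self _ _).trans hy.2.2.1).trans_lt hn
  have hyw : y + 1 < 2 ^ w := by have := hy.1; omega
  have s3 : Reaches queryProgram w mem 1 ⟨107, reg1⟩ _ :=
    Reaches.jlt (a := 9) (b := 10) (l := 113) rfl
  rw [tf 9 (by norm_num), tf 10 (by norm_num), hg.r9, r10, if_neg (lt_irrefl _)] at s3
  have s4 : Reaches queryProgram w mem 4 ⟨108, reg1⟩ _ :=
    Reaches.straight [.copy 10 3, .copy 11 27, .copy 12 24, .copy 0 1] _
      (by simp [Instr.Straight]) rfl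
  have s5 := s4.trans (Reaches.jmp (l := 34) rfl)
  generalize hreg2 : runRegs w mem _ _ = reg2 at s5
  have hone : 1 % 2 ^ w = 1 := Nat.mod_eq_of_lt (Nat.one_lt_two_pow (by omega))
  have v10 : reg2 10 = 1 := by
    rw [← hreg2]
    simp [runRegs, Instr.exec, Config.put, tf, hg.r3, hone]
  have v11 : reg2 11 = s := by
    rw [← hreg2]
    simp [runRegs, Instr.exec, Config.put, t27, Nat.mod_eq_of_lt hsw]
  have v12 : reg2 12 = u / s := by
    rw [← hreg2]
    simp [runRegs, Instr.exec, Config.put, t24, Nat.mod_eq_of_lt huw]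
  have v0 : reg2 0 = y + 1 := by
    rw [← hreg2]
    simp [runRegs, Instr.exec, Config.put, tf, r1, Nat.mod_eq_of_lt hyw]
  have hg2 : Globals w j W reg2 := by
    refine hg.of_frame fun i i1 i2 => ?_
    have j1 : i ≠ 0 := by omega
    have j2 : i ≠ 10 := by omega
    have j3 : i ≠ 11 := by omega
    have j4 : i ≠ 12 := by omega
    rw [← tf i (by omega), ← hreg2]
    simp [runRegs, Instr.exec, Config.put, j1, j2, j3, j4]
  clear hreg2 s4
  obtain ⟨reg3, s6, x27, x24, xf⟩ := reaches_decode h hn (by omega) hy hg2 v0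
  have s7 : Reaches queryProgram w mem 1 ⟨107, reg3⟩ _ :=
    Reaches.jlt (a := 9) (b := 10) (l := 113) rfl
  rw [xf 9 (by norm_num), xf 10 (by norm_num), hg2.r9, v10, if_pos one_pos] at s7
  have x11 : reg3 11 = s := by rw [xf _ (by norm_num), v11]
  have x12 : reg3 12 = u / s := by rw [xf _ (by norm_num), v12]
  obtain ⟨c, s8, hc, hres⟩ := reaches_compare (w := w) (mem := mem) (reg := reg3) (by omega)
    (by rwa [x27]) (by rwa [x11]) (by rwa [x24]) (by rwa [x12])
  refine ⟨c, ((((((s1.trans s2).trans s3).trans s5).trans s6).trans s7).trans s8).mono ?_, hc, ?_⟩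
  · simp; omega
  · rw [hres, x27, x11, x24, x12]
    simp only [eq_comm]

/-! ### Ranking the elements by class size -/

/-- The elements are ranked among the elements in classes of the same size, so that classes of the
same size have consecutive ranks. -/
theorem exists_rank {α : Type*} [Fintype α] (r : Setoid α) :
    ∃ (m : ℕ → ℕ) (φ : α → ℕ × ℕ), Function.Injective φ ∧
      (∀ a, 0 < (φ a).1 ∧ (φ a).1 ≤ Fintype.card α ∧ (φ a).2 < (φ a).1 * m (φ a).1) ∧
      (∀ a b, r a b ↔ (φ a).1 = (φ b).1 ∧ (φ a).2 / (φ a).1 = (φ b).2 / (φ b).1) ∧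
      ∑ s ∈ Finset.Icc 1 (Fintype.card α), s * m s = Fintype.card α := by
  classical
  let size : Quotient r → ℕ := fun c => Fintype.card {a // (⟦a⟧ : Quotient r) = c}
  let m : ℕ → ℕ := fun s => Fintype.card {c // size c = s}
  let idx : ∀ s, {c // size c = s} ≃ Fin (m s) := fun s => Fintype.equivFin _
  let pos : ∀ c, {a // (⟦a⟧ : Quotient r) = c} ≃ Fin (size c) := fun c => Fintype.equivFin _
  let i : α → ℕ := fun a => idx (size (⟦a⟧)) ⟨⟦a⟧, rfl⟩
  let p : α → ℕ := fun a => pos ⟦a⟧ ⟨a, rfl⟩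
  have hp : ∀ a, p a < size (⟦a⟧) := fun a => (pos ⟦a⟧ ⟨a, rfl⟩).2
  have hi : ∀ a, i a < m (size (⟦a⟧)) := fun a => (idx (size (⟦a⟧)) ⟨⟦a⟧, rfl⟩).2
  have hs : ∀ a, 0 < size (⟦a⟧) := fun a => (Nat.zero_le _).trans_lt (hp a)
  have hdiv : ∀ a, (size (⟦a⟧) * i a + p a) / size (⟦a⟧) = i a := fun a => by
    rw [Nat.mul_add_div (hs a), Nat.div_eq_of_lt (hp a), Nat.add_zero]
  have hmod : ∀ a, (size (⟦a⟧) * i a + p a) % size (⟦a⟧) = p a := fun a => by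
    rw [Nat.mul_add_mod, Nat.mod_eq_of_lt (hp a)]
  -- The numberings depend on the size or the class. Stating injectivity across two indices that are
  -- equal lets the equality be substituted before injectivity is applied.
  have idx_inj : ∀ (s t : ℕ) (c : {c // size c = s}) (d : {c // size c = t}), s = t →
      (idx s c : ℕ) = idx t d → c.1 = d.1 := by
    rintro s t c d rfl h
    rw [(idx s).injective (Fin.ext h)]
  have pos_inj : ∀ (c d : Quotient r) (a : {a // (⟦a⟧ : Quotient r) = c})
      (b : {a // (⟦a⟧ : Quotient r) = d}), c = d → (pos c a : ℕ) = pos d b → a.1 = b.1 := by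
    rintro c d a b rfl h
    rw [(pos c).injective (Fin.ext h)]
  have hclass : ∀ a b, size (⟦a⟧) = size (⟦b⟧) → i a = i b → (⟦a⟧ : Quotient r) = ⟦b⟧ :=
    fun a b h h' => idx_inj _ _ ⟨⟦a⟧, rfl⟩ ⟨⟦b⟧, rfl⟩ h h'
  -- The rank is the class number times the size plus the position in the class, so quotient and
  -- remainder by the size recover both.
  refine ⟨m, fun a => (size (⟦a⟧), size (⟦a⟧) * i a + p a), ?_, ?_, ?_, ?_⟩
  · intro a b h
    obtain ⟨h1, h2⟩ := Prod.mk.inj h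
    have h3 : i a = i b := by rw [← hdiv a, ← hdiv b, h2, h1]
    have h4 : p a = p b := by rw [← hmod a, ← hmod b, h2, h1]
    exact pos_inj _ _ ⟨a, rfl⟩ ⟨b, rfl⟩ (hclass a b h1 h3) h4
  · refine fun a => ⟨hs a, Fintype.card_subtype_le _, ?_⟩
    have := Nat.mul_le_mul_left (size (⟦a⟧)) (hi a)
    have := hp a
    dsimp only
    rw [Nat.mul_succ] at *
    omega
  · intro a b
    simp only [hdiv]
    constructor
    · intro h
      have h' : (⟦a⟧ : Quotient r) = ⟦b⟧ := Quotient.sound h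
      have : ∀ c d : Quotient r, c = d → size c = size d ∧
          (idx (size c) ⟨c, rfl⟩ : ℕ) = idx (size d) ⟨d, rfl⟩ := by
        rintro c d rfl; exact ⟨rfl, rfl⟩
      exact this _ _ h'
    · rintro ⟨h1, h2⟩
      exact Quotient.exact (hclass a b h1 h2)
  · have h1 : Fintype.card α = ∑ c : Quotient r, size c := by
      rw [← Fintype.card_sigma]
      exact Fintype.card_congr (Equiv.sigmaFiberEquiv (fun a => (⟦a⟧ : Quotient r))).symm
    have h2 : ∀ c ∈ (Finset.univ : Finset (Quotient r)),
        size c ∈ Finset.Icc 1 (Fintype.card α) := by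
      intro c _
      obtain ⟨a, rfl⟩ := Quotient.exists_rep c
      exact Finset.mem_Icc.2 ⟨hs a, Fintype.card_subtype_le _⟩
    conv_rhs => rw [h1, ← Finset.sum_fiberwise_of_maps_to h2]
    refine Finset.sum_congr rfl fun s _ => ?_
    rw [Finset.sum_congr rfl (fun c hc => (Finset.mem_filter.1 hc).2), Finset.sum_const,
      smul_eq_mul, mul_comm, ← Fintype.card_subtype]

/-! ### Covering all class sizes by few blocks -/

/-- A block describes some classes; it consists of a size, and a list of pairs of a difference of
sizes and a multiplicity. -/
abbrev Block : Type := ℕ × List (ℕ × ℕ)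

/-- The block can be stored with fields of `j` bits and decoded with numbers up to `n`. -/
structure Block.Valid (j n : ℕ) (b : Block) : Prop where
  base_le : b.1 ≤ n
  length_le : b.2.length ≤ j
  entry : ∀ e ∈ b.2, e.1 < 2 ^ j ∧ 0 < e.2 ∧ e.2 < 2 ^ j ∧ (b.1 + e.1) * e.2 ≤ n

/-- There are at most `N` blocks that describe the classes whose sizes are in `F`, where `m` gives
the multiplicities. -/
def Covers (j n : ℕ) (m : ℕ → ℕ) (F : Finset ℕ) (N : ℕ) : Prop :=
  ∃ L : List (ℕ × Block), L.length ≤ N ∧ (L.map Prod.fst).sum = ∑ s ∈ F, s * m s ∧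
    (∀ b ∈ L, 0 < b.1 ∧ b.2.Valid j n) ∧
    ∀ s ∈ F, ∀ u < s * m s, ∃ b ∈ L, ∃ r < b.1, scan b.2.1 b.2.2 r = (s, u)

theorem Covers.empty (j n : ℕ) (m : ℕ → ℕ) : Covers j n m ∅ 0 := ⟨[], by simp⟩

theorem Covers.union {j n : ℕ} {m : ℕ → ℕ} {F G : Finset ℕ} {N N' : ℕ} (h : Covers j n m F N)
    (h' : Covers j n m G N') (hd : Disjoint F G) : Covers j n m (F ∪ G) (N + N') := by
  obtain ⟨L, h1, h2, h3, h4⟩ := h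
  obtain ⟨L', h1', h2', h3', h4'⟩ := h'
  refine ⟨L ++ L', by simp; omega, by simp [h2, h2', Finset.sum_union hd], fun b hb => ?_,
    fun s hs u hu => ?_⟩
  · rcases List.mem_append.1 hb with hb | hb
    exacts [h3 b hb, h3' b hb]
  · rcases Finset.mem_union.1 hs with hs | hs
    · obtain ⟨b, hb, hr⟩ := h4 s hs u hu
      exact ⟨b, List.mem_append_left _ hb, hr⟩
    · obtain ⟨b, hb, hr⟩ := h4' s hs u hu
      exact ⟨b, List.mem_append_right _ hb, hr⟩

/-- Each size gets its own block with an empty list. Then `scan` returns the base whatever the rank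
is, so the multiplicity is not stored and may be arbitrarily large. -/
theorem covers_of_card {j n : ℕ} {m : ℕ → ℕ} (F : Finset ℕ)
    (hF : ∀ s ∈ F, s ≤ n ∧ 0 < s * m s) : Covers j n m F F.card := by
  refine ⟨F.toList.map fun s => (s * m s, (s, [])), by simp, ?_, ?_, ?_⟩
  · simp [Function.comp_def, Finset.sum_map_toList]
  · intro b hb
    obtain ⟨s, hs, rfl⟩ := List.mem_map.1 hb
    have := hF s (Finset.mem_toList.1 hs)
    exact ⟨this.2, this.1, by simp, by simp⟩
  · intro s hs u hu
    exact ⟨_, List.mem_map.2 ⟨s, Finset.mem_toList.2 hs, rfl⟩, u, hu, rfl⟩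

/-- The rank sought is `u` plus the numbers of elements of the sizes that precede `s` in the list.
-/
theorem exists_scan_eq (base : ℕ) (m : ℕ → ℕ) (l : List ℕ) (hl : ∀ s ∈ l, base ≤ s) :
    ∀ s ∈ l, ∀ u < s * m s, ∃ r < (l.map fun s => s * m s).sum,
      scan base (l.map fun s => (s - base, m s)) r = (s, u) := by
  induction l with
  | nil => simp
  | cons t l ih =>
    intro s hs u hu
    have ht : base + (t - base) = t := Nat.add_sub_cancel' (hl t (by simp))
    by_cases hst : s = t
    · subst hst
      refine ⟨u, by simp; omega, ?_⟩
      simp [scan, ht, hu]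
    · obtain ⟨r, hr, h⟩ := ih (fun s hs => hl s (by simp [hs])) s
        ((List.mem_cons.1 hs).resolve_left hst) u hu
      refine ⟨t * m t + r, by simpa using hr, ?_⟩
      simpa [scan, ht] using h

theorem covers_one {j n base : ℕ} {m : ℕ → ℕ} (F : Finset ℕ) (hj : F.card ≤ j)
    (hF : ∀ s ∈ F, base ≤ s ∧ s < base + 2 ^ j ∧ 0 < s ∧ 0 < m s ∧ m s < 2 ^ j ∧ s * m s ≤ n) :
    Covers j n m F 1 := by
  rcases F.eq_empty_or_nonempty with rfl | ⟨t, ht⟩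
  -- An empty set of sizes needs the empty list, since a block must have positive weight.
  · exact ⟨[], by simp⟩
  refine ⟨[((F.toList.map fun s => s * m s).sum, (base, F.toList.map fun s => (s - base, m s)))],
    by simp, by simp [Finset.sum_map_toList], ?_, ?_⟩
  · intro b hb
    rw [List.mem_singleton.1 hb]
    refine ⟨?_, ?_, by simpa using hj, ?_⟩
    · rw [Finset.sum_map_toList]
      obtain ⟨-, -, h1, h2, -⟩ := hF t ht
      exact (Nat.mul_pos h1 h2).trans_le
        (Finset.single_le_sum (f := fun s => s * m s) (fun _ _ => Nat.zero_le _) ht)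
    · obtain ⟨h0, -, -, h1, -, h2⟩ := hF t ht
      exact h0.trans ((Nat.le_mul_of_pos_right _ h1).trans h2)
    · intro e he
      obtain ⟨s, hs, rfl⟩ := List.mem_map.1 he
      obtain ⟨h1, h2, h3, h4, h5, h6⟩ := hF s (Finset.mem_toList.1 hs)
      refine ⟨by simp; omega, h4, h5, ?_⟩
      simpa [Nat.add_sub_cancel' h1] using h6
  · intro s hs u hu
    obtain ⟨r, hr, h⟩ := exists_scan_eq base m F.toList
      (fun s hs => (hF s (Finset.mem_toList.1 hs)).1) s (Finset.mem_toList.2 hs) u hu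
    exact ⟨_, List.mem_singleton.2 rfl, r, hr, h⟩

/-- Groups of `j` sizes are split off until at most `j` remain, so at most one block is not full;
this is the extra summand `j`. -/
theorem exists_covers_window {j n base : ℕ} {m : ℕ → ℕ} (hj : 0 < j) :
    ∀ (c : ℕ) (F : Finset ℕ), F.card = c → (∀ s ∈ F, base ≤ s ∧ s < base + 2 ^ j ∧ 0 < s ∧
      0 < m s ∧ m s < 2 ^ j ∧ s * m s ≤ n) → ∃ N, Covers j n m F N ∧ j * N ≤ F.card + j := by
  intro c
  induction c using Nat.strong_induction_on with
  | _ c ih =>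
    intro F hc hF
    rcases le_or_gt F.card j with h | h
    · exact ⟨1, covers_one F h hF, by omega⟩
    · obtain ⟨G, hG, hGc⟩ := Finset.exists_subset_card_eq h.le
      have hcard : (F \ G).card + j = F.card := by
        rw [← hGc, Finset.card_sdiff_add_card_eq_card hG]
      obtain ⟨N, hN, hb⟩ := ih (F \ G).card (by omega) (F \ G) rfl
        fun s hs => hF s (Finset.sdiff_subset hs)
      refine ⟨N + 1, ?_, by rw [Nat.mul_succ]; omega⟩
      have := hN.union (covers_one G hGc.le fun s hs => hF s (hG hs)) Finset.sdiff_disjoint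
      rwa [Finset.sdiff_union_of_subset hG] at this

/-- The sizes are cut into `K` windows of length `2 ^ j`, and each window costs at most one block
that is not full. -/
theorem exists_covers_of_lt {j n : ℕ} {m : ℕ → ℕ} (hj : 0 < j) :
    ∀ (K : ℕ) (F : Finset ℕ), (∀ s ∈ F, s < K * 2 ^ j ∧ 0 < s ∧
      0 < m s ∧ m s < 2 ^ j ∧ s * m s ≤ n) → ∃ N, Covers j n m F N ∧ j * N ≤ F.card + K * j := by
  intro K
  induction K with
  | zero =>
    intro F hF
    have : F = ∅ := Finset.eq_empty_of_forall_notMem fun s hs => by simpa using (hF s hs).1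
    subst this
    exact ⟨0, Covers.empty _ _ _, by simp⟩
  | succ K ih =>
    intro F hF
    obtain ⟨N, hN, hb⟩ := ih (F.filter (· < K * 2 ^ j)) fun s hs => by
      obtain ⟨h1, h2⟩ := Finset.mem_filter.1 hs
      exact ⟨h2, (hF s h1).2⟩
    obtain ⟨N', hN', hb'⟩ := exists_covers_window (base := K * 2 ^ j) hj _
      (F.filter fun s => ¬ s < K * 2 ^ j) rfl fun s hs => by
        obtain ⟨h1, h2⟩ := Finset.mem_filter.1 hs
        have := hF s h1
        rw [Nat.succ_mul] at this
        exact ⟨not_lt.1 h2, this⟩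
    refine ⟨N + N', ?_, ?_⟩
    · have := hN.union hN' (Finset.disjoint_filter_filter_not _ _ _)
      rwa [Finset.filter_union_filter_not_eq] at this
    · have := Finset.card_filter_add_card_filter_not (s := F) (· < K * 2 ^ j)
      rw [Nat.mul_add, Nat.succ_mul]
      omega

/-- The largest of `k` distinct positive integers is at least `k`, so their sum grows quadratically.
This is the source of √n. -/
theorem card_sq_le_two_mul_sum (F : Finset ℕ) (hF : ∀ s ∈ F, 0 < s) :
    F.card ^ 2 ≤ 2 * ∑ s ∈ F, s := by
  induction F using Finset.induction_on_max with
  | empty => simp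
  | insert a F ha ih =>
    have hna : a ∉ F := fun h => lt_irrefl _ (ha a h)
    have h1 : F ⊆ Finset.Ico 1 a := fun x hx =>
      Finset.mem_Ico.2 ⟨hF x (by simp [hx]), ha x hx⟩
    have h2 := Finset.card_le_card h1
    have h3 := hF a (by simp)
    rw [Nat.card_Ico] at h2
    have h4 := ih fun s hs => hF s (by simp [hs])
    rw [Finset.card_insert_of_notMem hna, Finset.sum_insert hna]
    have : F.card + 1 ≤ a := by omega
    nlinarith

/-- Sizes that are small and rare share blocks by windows; all others get their own. With factor
`j`, the shared blocks contribute `2 * R` for the distinct sizes and `R + j` for the windows, the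
frequent sizes `2 * R`, and the large sizes `R`. -/
theorem exists_covers {j n R : ℕ} {m : ℕ → ℕ} (hj : 0 < j) (hj2 : j ^ 2 ≤ 2 ^ j) (hR : n < R ^ 2)
    (F : Finset ℕ) (hF : ∀ s ∈ F, 0 < s ∧ 0 < m s) (hsum : ∑ s ∈ F, s * m s = n) :
    ∃ N, Covers j n m F N ∧ j * N ≤ 6 * R + j := by
  have hle : ∀ s ∈ F, s * m s ≤ n := fun s hs => by
    rw [← hsum]
    exact Finset.single_le_sum (f := fun s => s * m s) (fun _ _ => Nat.zero_le _) hs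
  -- The threshold `K * 2 ^ j` is at least `R * j`, so at most `R / j` sizes exceed it, while `K * j
  -- ≤ R + j` makes the windows cheap.
  set K := R * j / 2 ^ j + 1 with hK
  have hKR : R * j ≤ K * 2 ^ j := by
    rw [hK, Nat.succ_mul]
    have := Nat.div_add_mod' (R * j) (2 ^ j)
    have := Nat.mod_lt (R * j) (show 0 < 2 ^ j by positivity)
    omega
  have hKj : K * j ≤ R + j := by
    rw [hK, Nat.succ_mul]
    refine Nat.add_le_add_right ?_ _
    calc R * j / 2 ^ j * j = j * (R * j / 2 ^ j) := mul_comm _ _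
      _ ≤ j * (R * j) / 2 ^ j := Nat.mul_div_le_mul_div_assoc _ _ _
      _ ≤ R * 2 ^ j / 2 ^ j := Nat.div_le_div_right (by
        rw [mul_left_comm, ← sq]; gcongr)
      _ = R := Nat.mul_div_cancel _ (by positivity)
  obtain ⟨N, hN, hb⟩ := exists_covers_of_lt (m := m) (n := n) hj K
    (F.filter fun s => m s < 2 ^ j ∧ s < K * 2 ^ j) fun s hs => by
      obtain ⟨h1, h2, h3⟩ := Finset.mem_filter.1 hs
      exact ⟨h3, (hF s h1).1, (hF s h1).2, h2, hle s h1⟩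
  have hN' := covers_of_card (j := j) (n := n) (m := m)
    (F.filter fun s => ¬ (m s < 2 ^ j ∧ s < K * 2 ^ j)) fun s hs => by
      have h1 := (Finset.mem_filter.1 hs).1
      exact ⟨(Nat.le_mul_of_pos_right _ (hF s h1).2).trans (hle s h1),
        Nat.mul_pos (hF s h1).1 (hF s h1).2⟩
  have hcover := hN.union hN' (Finset.disjoint_filter_filter_not _ _ _)
  rw [Finset.filter_union_filter_not_eq] at hcover
  refine ⟨_, hcover, ?_⟩
  have hsumF : ∀ G ⊆ F, ∑ s ∈ G, s * m s ≤ n := fun G hG => by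
    rw [← hsum]; exact Finset.sum_le_sum_of_subset hG
  have c1 : (F.filter fun s => m s < 2 ^ j ∧ s < K * 2 ^ j).card ≤ 2 * R := by
    refine (Finset.card_le_card (Finset.filter_subset _ _)).trans ?_
    have h1 := card_sq_le_two_mul_sum F fun s hs => (hF s hs).1
    have h2 : ∑ s ∈ F, s ≤ ∑ s ∈ F, s * m s :=
      Finset.sum_le_sum fun s hs => Nat.le_mul_of_pos_right _ (hF s hs).2
    rw [hsum] at h2
    nlinarith
  have c2 : j * (F.filter fun s => 2 ^ j ≤ m s).card ≤ 2 * R := by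
    set G := F.filter fun s => 2 ^ j ≤ m s with hG
    have h1 := card_sq_le_two_mul_sum G fun s hs => (hF s (Finset.mem_filter.1 hs).1).1
    have h2 : (∑ s ∈ G, s) * 2 ^ j ≤ ∑ s ∈ G, s * m s := by
      rw [Finset.sum_mul]
      exact Finset.sum_le_sum fun s hs => Nat.mul_le_mul_left _ (Finset.mem_filter.1 hs).2
    have h3 := hsumF G (Finset.filter_subset _ _)
    -- A frequent size `s` accounts for at least `s * 2 ^ j` elements, so the number of these sizes
    -- is smaller by a factor of about `2 ^ (j / 2)`, and this is at least `j`.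
    have h4 : (j * G.card) ^ 2 ≤ 2 * R ^ 2 := by
      calc (j * G.card) ^ 2 = j ^ 2 * G.card ^ 2 := by ring
        _ ≤ 2 ^ j * (2 * ∑ s ∈ G, s) := Nat.mul_le_mul hj2 h1
        _ = 2 * ((∑ s ∈ G, s) * 2 ^ j) := by ring
        _ ≤ 2 * R ^ 2 := by omega
    nlinarith
  have c3 : j * (F.filter fun s => K * 2 ^ j ≤ s).card ≤ R := by
    set G := F.filter fun s => K * 2 ^ j ≤ s with hG
    have h2 : G.card * (R * j) ≤ ∑ s ∈ G, s * m s := by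
      rw [← smul_eq_mul]
      refine Finset.card_nsmul_le_sum _ _ _ fun s hs => ?_
      obtain ⟨h1, h2⟩ := Finset.mem_filter.1 hs
      exact hKR.trans (h2.trans (Nat.le_mul_of_pos_right _ (hF s h1).2))
    have h3 := hsumF G (Finset.filter_subset _ _)
    have hR0 : 0 < R := by
      by_contra h
      have : R = 0 := by omega
      simp [this] at hR
    have : R * (j * G.card) ≤ R * R := by nlinarith
    exact Nat.le_of_mul_le_mul_left this hR0
  have c4 : (F.filter fun s => ¬ (m s < 2 ^ j ∧ s < K * 2 ^ j)).card ≤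
      (F.filter fun s => 2 ^ j ≤ m s).card + (F.filter fun s => K * 2 ^ j ≤ s).card := by
    refine le_trans (Finset.card_le_card fun s hs => ?_) (Finset.card_union_le _ _)
    obtain ⟨h1, h2⟩ := Finset.mem_filter.1 hs
    rw [Finset.mem_union, Finset.mem_filter, Finset.mem_filter]
    rcases not_and_or.1 h2 with h | h
    exacts [.inl ⟨h1, not_lt.1 h⟩, .inr ⟨h1, not_lt.1 h⟩]
  have c5 := Nat.mul_le_mul_left j c4
  rw [Nat.mul_add] at c5 ⊢
  omega

/-! ### Distributing blocks to buckets of equal size -/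

/-- A range of labels that is divided into a piece of one block and another complete block. -/
structure Bucket (β : Type*) where
  cut : ℕ
  off : ℕ
  fst : β
  snd : β

/-- The block at a position in a bucket, and the rank in this block. -/
def Bucket.get {β : Type*} (B : Bucket β) (p : ℕ) : β × ℕ :=
  if p < B.cut then (B.fst, p + B.off) else (B.snd, p - B.cut)

/-- The alias method: blocks can be distributed to equally many buckets of the same size so that
each bucket has pieces of at most two blocks. -/
theorem exists_buckets {β : Type*} (W : ℕ) :
    ∀ (m : ℕ) (L : List (ℕ × β)), L.length = m → 0 < m →
      (m - 1) * W < (L.map Prod.fst).sum → (L.map Prod.fst).sum ≤ m * W →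
      ∃ Bs : List (Bucket β), Bs.length = m ∧
        (∀ B ∈ Bs, B.cut ≤ W ∧ (∃ b ∈ L, B.off ≤ b.1 ∧ B.fst = b.2) ∧ ∃ b ∈ L, B.snd = b.2) ∧
        ∀ b ∈ L, ∀ r < b.1, ∃ x < (L.map Prod.fst).sum, ∃ B, Bs[x / W]? = some B ∧
          B.get (x % W) = (b.2, r) := by
  intro m
  induction m with
  | zero => intro L _ h; exact absurd h (lt_irrefl _)
  | succ m ih =>
    intro L hL _ hlo hhi
    rcases Nat.eq_zero_or_pos m with rfl | hm
    · obtain ⟨b, rfl⟩ := List.length_eq_one_iff.1 hL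
      refine ⟨[⟨0, 0, b.2, b.2⟩], rfl, by simp, ?_⟩
      intro b' hb' r hr
      rw [List.mem_singleton.1 hb'] at hr ⊢
      have hb : b.1 ≤ W := by simpa using hhi
      have hrW : r < W := by omega
      exact ⟨r, by simpa using hr, _, by rw [Nat.div_eq_of_lt hrW]; rfl,
        by simp [Bucket.get, Nat.mod_eq_of_lt hrW]⟩
    · have hW : 0 < W := by
        rcases Nat.eq_zero_or_pos W with rfl | h
        · simp at hlo hhi; omega
        · exact h
      -- By averaging, some block fits into a bucket, and some other block is large enough to fill
      -- the rest of that bucket. The lower bound on the total ensures the latter.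
      obtain ⟨a, ha, haW⟩ : ∃ a ∈ L, a.1 ≤ W := by
        by_contra! h
        have := List.card_nsmul_le_sum (L.map Prod.fst) (W + 1) (by
          intro x hx
          obtain ⟨b, hb, rfl⟩ := List.mem_map.1 hx
          exact h b hb)
        rw [List.length_map, hL, smul_eq_mul] at this
        nlinarith
      obtain ⟨L', hperm⟩ : ∃ L', L.Perm (a :: L') := by
        classical exact ⟨_, List.perm_cons_erase ha⟩
      have hlen' : L'.length = m := by
        have := hperm.length_eq
        rw [hL, List.length_cons] at this
        omega
      have hsum' : (L.map Prod.fst).sum = a.1 + (L'.map Prod.fst).sum := by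
        rw [(hperm.map Prod.fst).sum_eq]; simp
      obtain ⟨c, hc, hcW⟩ : ∃ c ∈ L', W - a.1 ≤ c.1 := by
        by_contra! h
        obtain ⟨d, hd⟩ : ∃ d, W = a.1 + d + 1 := by
          obtain ⟨c, hc⟩ := List.exists_mem_of_length_pos (hlen' ▸ hm)
          exact ⟨W - a.1 - 1, by have := h c hc; omega⟩
        have := List.sum_le_card_nsmul (L'.map Prod.fst) d (by
          intro x hx
          obtain ⟨b, hb, rfl⟩ := List.mem_map.1 hx
          have := h b hb
          omega)
        rw [List.length_map, hlen', smul_eq_mul] at this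
        simp only [Nat.add_sub_cancel] at hlo
        subst hd
        nlinarith
      obtain ⟨L'', hperm'⟩ : ∃ L'', L'.Perm (c :: L'') := by
        classical exact ⟨_, List.perm_cons_erase hc⟩
      have hlen'' : L''.length + 1 = m := by
        rw [← hlen', hperm'.length_eq, List.length_cons]
      have hsum'' : (L'.map Prod.fst).sum = c.1 + (L''.map Prod.fst).sum := by
        rw [(hperm'.map Prod.fst).sum_eq]; simp
      set T := (L.map Prod.fst).sum with hT
      set v := W - a.1 with hv
      -- The bucket takes the last `v` ranks of `c`. What is left of `c` still starts at rank 0 and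
      -- can be treated as a block. Total and number of buckets drop by `W` and by 1, so both bounds
      -- persist, and only the last bucket can be incomplete.
      obtain ⟨Bs, hBs, hval, hget⟩ := ih ((c.1 - v, c.2) :: L'') (by simpa using hlen'') hm
        (by
          simp only [List.map_cons, List.sum_cons]
          obtain ⟨m', rfl⟩ : ∃ m', m = m' + 1 := ⟨m - 1, by omega⟩
          simp only [Nat.add_sub_cancel, Nat.succ_mul] at hlo ⊢
          omega)
        (by
          simp only [List.map_cons, List.sum_cons]
          rw [Nat.succ_mul] at hhi
          omega)
      have hsum3 : (((c.1 - v, c.2) :: L'').map Prod.fst).sum + W = T := by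
        simp only [List.map_cons, List.sum_cons]
        omega
      have hcL : c ∈ L := hperm.mem_iff.2 (List.mem_cons_of_mem _ hc)
      have hL'' : ∀ b ∈ L'', b ∈ L := fun b hb =>
        hperm.mem_iff.2 (List.mem_cons_of_mem _ (hperm'.mem_iff.2 (List.mem_cons_of_mem _ hb)))
      have later : ∀ b ∈ ((c.1 - v, c.2) :: L''), ∀ r < b.1, ∃ x < T, ∃ B,
          ((⟨v, c.1 - v, c.2, a.2⟩ : Bucket β) :: Bs)[x / W]? = some B ∧
            B.get (x % W) = (b.2, r) := by
        intro b hb r hr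
        obtain ⟨x, hx, B, h1, h2⟩ := hget b hb r hr
        refine ⟨x + W, by omega, B, ?_, by simpa using h2⟩
        rw [Nat.add_div_right _ hW]
        simpa using h1
      refine ⟨⟨v, c.1 - v, c.2, a.2⟩ :: Bs, by simp [hBs], ?_, ?_⟩
      · intro B hB
        rcases List.mem_cons.1 hB with rfl | hB
        · exact ⟨by simp; omega, ⟨c, hcL, by simp, rfl⟩, a, ha, rfl⟩
        · obtain ⟨h1, ⟨b, hb, h2, h3⟩, b', hb', h4⟩ := hval B hB
          refine ⟨h1, ?_, ?_⟩
          · rcases List.mem_cons.1 hb with rfl | hb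
            · exact ⟨c, hcL, h2.trans (by simp), h3⟩
            · exact ⟨b, hL'' b hb, h2, h3⟩
          · rcases List.mem_cons.1 hb' with rfl | hb'
            · exact ⟨c, hcL, h4⟩
            · exact ⟨b', hL'' b' hb', h4⟩
      · intro b hb r hr
        rcases List.mem_cons.1 (hperm.mem_iff.1 hb) with rfl | hb
        · refine ⟨v + r, by omega, _, by rw [Nat.div_eq_of_lt (by omega)]; rfl, ?_⟩
          rw [Nat.mod_eq_of_lt (by omega)]
          simp [Bucket.get]
        · rcases List.mem_cons.1 (hperm'.mem_iff.1 hb) with rfl | hb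
          · rcases lt_or_ge r (b.1 - v) with h | h
            · exact later (b.1 - v, b.2) (by simp) r h
            · refine ⟨r - (b.1 - v), by omega, _, by rw [Nat.div_eq_of_lt (by omega)]; rfl, ?_⟩
              rw [Nat.mod_eq_of_lt (by omega), Bucket.get, if_pos (by simp; omega)]
              simp; omega
          · exact later b (by simp [hb]) r hr

/-! ### The layout of the cells -/

theorem pairCode_lt (j : ℕ) (es : List (ℕ × ℕ)) (h : ∀ e ∈ es, e.1 < 2 ^ j ∧ e.2 < 2 ^ j) :
    pairCode j es < 2 ^ (2 * j * es.length) := by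
  induction es with
  | nil => simp [pairCode]
  | cons e es ih =>
    have h1 := ih fun e he => h e (by simp [he])
    obtain ⟨h2, h3⟩ := h e (by simp)
    have h4 : 2 ^ (2 * j * (e :: es).length) = 2 ^ j * (2 ^ j * 2 ^ (2 * j * es.length)) := by
      rw [List.length_cons, Nat.mul_succ, ← pow_add, ← pow_add]
      congr 1; ring
    rw [h4, pairCode]
    generalize 2 ^ (2 * j * es.length) = Q at *
    have h5 : e.2 + 2 ^ j * pairCode j es + 1 ≤ 2 ^ j * Q := by nlinarith
    nlinarith

theorem getD_flatMap {β : Type*} (f : β → List ℕ) (k : ℕ) (hf : ∀ b, (f b).length = k)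
    (l : List β) : ∀ (i c : ℕ) (b : β), l[i]? = some b → c < k →
      (l.flatMap f).getD (k * i + c) 0 = (f b).getD c 0 := by
  induction l with
  | nil => simp
  | cons a l ih =>
    intro i c b h hc
    rw [List.flatMap_cons]
    cases i with
    | zero =>
      obtain rfl : a = b := by simpa using h
      rw [List.getD_append _ _ _ _ (by rw [hf]; omega)]
      simp
    | succ i =>
      rw [List.getD_append_right _ _ _ _ (by rw [hf, Nat.mul_succ]; omega), hf,
        show k * (i + 1) + c - k = k * i + c by rw [Nat.mul_succ]; omega]
      exact ih i c b (by simpa using h) hc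

/-- The cells that store a bucket. -/
def Bucket.cells (j : ℕ) (B : Bucket Block) : List ℕ :=
  [B.cut, B.off, B.fst.1, pairCode j B.fst.2, B.snd.1, pairCode j B.snd.2]

/-- The cells of the data structure with buckets of size `W`. -/
def allCells (j W : ℕ) (Bs : List (Bucket Block)) : List ℕ :=
  2 ^ j :: W :: Bs.flatMap (Bucket.cells j)

theorem length_allCells (j W : ℕ) (Bs : List (Bucket Block)) :
    (allCells j W Bs).length = 2 + 6 * Bs.length := by
  simp [allCells, List.length_flatMap, Bucket.cells]
  ring

theorem allCells_getD (j W : ℕ) (Bs : List (Bucket Block)) {i c : ℕ} {B : Bucket Block}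
    (h : Bs[i]? = some B) (hc : c < 6) :
    (allCells j W Bs).getD (2 + 6 * i + c) 0 = (B.cells j).getD c 0 := by
  rw [show 2 + 6 * i + c = 6 * i + c + 1 + 1 by ring, allCells, List.getD_cons_succ,
    List.getD_cons_succ]
  exact getD_flatMap _ 6 (fun _ => rfl) _ _ _ _ h hc

theorem decodes_of_bucket {n j W x s u r : ℕ} {Bs : List (Bucket Block)} {B : Bucket Block}
    {b : Block} (hB : Bs[x / W]? = some B) (hget : B.get (x % W) = (b, r)) (hb : b.Valid j n)
    (hscan : scan b.1 b.2 r = (s, u)) (hx : x < n) (hs : s ≤ n) (hu : u ≤ n) (hr : r ≤ n) :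
    Decodes n j W (allCells j W Bs).length (fun c => (allCells j W Bs).getD c 0) x s u := by
  have hi : x / W < Bs.length := (List.getElem?_eq_some_iff.1 hB).1
  have hc := fun c hc => allCells_getD j W Bs (c := c) hB hc
  have h0 := hc 0 (by norm_num)
  have h1 := hc 1 (by norm_num)
  have h2 := hc 2 (by norm_num)
  have h3 := hc 3 (by norm_num)
  have h4 := hc 4 (by norm_num)
  have h5 := hc 5 (by norm_num)
  simp only [Bucket.cells, add_zero, List.getD_cons_zero, List.getD_cons_succ] at h0 h1 h2 h3 h4 h5
  refine ⟨hx, hs, hu, by rw [length_allCells]; omega, ?_⟩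
  obtain ⟨hv1, hv2, hv3⟩ := hb
  rw [Bucket.get] at hget
  split_ifs at hget with hcut
  · obtain ⟨rfl, rfl⟩ := Prod.mk.inj hget
    refine ⟨2 + 6 * (x / W) + 2, _, B.fst.2, hr, hv2, .inl ⟨?_, ?_, rfl⟩, ?_, h3, ?_, ?_⟩
    · simpa only [h0] using hcut
    · simp only [h1]
    · simpa only [h2] using hv1
    · simpa only [h2] using hv3
    · simpa only [h2] using hscan
  · obtain ⟨rfl, rfl⟩ := Prod.mk.inj hget
    refine ⟨2 + 6 * (x / W) + 4, _, B.snd.2, hr, hv2, .inr ⟨?_, ?_, rfl⟩, ?_, h5, ?_, ?_⟩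
    · simpa only [h0] using not_lt.1 hcut
    · simp only [h0]
    · simpa only [h4] using hv1
    · simpa only [h4] using hv3
    · simpa only [h4] using hscan

/-- The contents must fit into a cell, to be stored, and into a word, to be handled by the program.
The code of at most `j` pairs has `2 * j * j` bits, which is why this number is bounded by both
widths. -/
theorem hasCells_allCells {n w j W : ℕ} {Bs : List (Bucket Block)} (hw : 1 < w) (hn : n < 2 ^ w)
    (hj : 2 ^ j < 2 ^ w) (hjw : 2 * j * j ≤ w) (hjj : 2 * j * j ≤ 2 ^ j) (hnj : n < 2 ^ 2 ^ j)
    (hW : W ≤ n)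
    (hB : ∀ B ∈ Bs, B.cut ≤ n ∧ B.off ≤ n ∧ B.fst.Valid j n ∧ B.snd.Valid j n)
    (haddr : (allCells j W Bs).length * 2 ^ j < 2 ^ w) :
    HasCells w j (allCells j W Bs).length (fun c => (allCells j W Bs).getD c 0)
      (packed w (bitList (2 ^ j * (allCells j W Bs).length)
        (Nat.ofDigits (2 ^ 2 ^ j) (allCells j W Bs)))) := by
  have hcode : ∀ b : Block, b.Valid j n → pairCode j b.2 < 2 ^ (2 * j * j) := fun b hb =>
    (pairCode_lt j b.2 fun e he => ⟨(hb.entry e he).1, (hb.entry e he).2.2.1⟩).trans_le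
      (Nat.pow_le_pow_right (by norm_num) (Nat.mul_le_mul_left _ hb.length_le))
  -- The bound is proved for a general `v`, to be used for the width of a cell and for the width of
  -- a word.
  have hall : ∀ v, n < v → 2 ^ j < v → 2 ^ (2 * j * j) ≤ v → ∀ c ∈ allCells j W Bs, c < v := by
    intro v hv1 hv2 hv3 c hc
    simp only [allCells, List.mem_cons, List.mem_flatMap] at hc
    rcases hc with rfl | rfl | ⟨B, hBm, hc⟩
    · exact hv2
    · omega
    · obtain ⟨h1, h2, h3, h4⟩ := hB B hBm
      have h5 := hcode _ h3
      have h6 := hcode _ h4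
      have h7 := h3.base_le
      have h8 := h4.base_le
      simp only [Bucket.cells, List.mem_cons, List.not_mem_nil, or_false] at hc
      omega
  have hq := hall (2 ^ 2 ^ j) hnj (Nat.pow_lt_pow_right (by norm_num) Nat.lt_two_pow_self)
    (Nat.pow_le_pow_right (by norm_num) hjj)
  have hww := hall (2 ^ w) hn hj (Nat.pow_le_pow_right (by norm_num) hjw)
  refine ⟨hw, hj, ⟨_, packed_bitList w (ofDigits_two_pow_lt _ _ hq),
    fun c => (ofDigits_two_pow_cell _ _ hq c).symm⟩, fun c => ?_, haddr⟩
  rcases lt_or_ge c (allCells j W Bs).length with h | h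
  · rw [List.getD_eq_getElem _ _ h]
    exact hww _ (List.getElem_mem h)
  · rw [List.getD_eq_default _ _ h]
    positivity

/-! ### The representations for small and for large words -/

theorem Reaches.answers {P : Program} {w T x y ans : ℕ} {D : List Bool} {c : Config}
    (h : Reaches P w (packed w D) T (init w x y) c) (hc : P.at c.pc = .halt)
    (hans : c.reg 0 = ans) : ∃ t ≤ T, Answers P w D x y t ans := by
  obtain ⟨t, ht, rfl⟩ := h
  exact ⟨t, ht, hc, hans⟩

theorem represents_of_reaches {α : Type*} {P : Program} {w T : ℕ} {r : Setoid α} {label : α → ℕ}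
    {D : List Bool} {p : α → α → Prop} [∀ a b, Decidable (p a b)] (hp : ∀ a b, r a b ↔ p a b)
    {T' : ℝ} (hT : (T : ℝ) ≤ T')
    (h : ∀ a b, ∃ c, Reaches P w (packed w D) T (init w (label a) (label b)) c ∧
      P.at c.pc = .halt ∧ c.reg 0 = if p a b then 1 else 0) :
    Represents P w r label D T' := by
  intro a b
  obtain ⟨c, h1, h2, h3⟩ := h a b
  obtain ⟨t, ht, hans⟩ := h1.answers h2 h3
  refine ⟨t, le_trans (by exact_mod_cast ht) hT, fun hr => ?_, fun hr => ?_⟩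
  · rwa [if_pos ((hp a b).1 hr)] at hans
  · rwa [if_neg (mt (hp a b).2 hr)] at hans

/-- The representation for small words. -/
theorem exists_array {α : Type*} [Fintype α] (r : Setoid α) {w : ℕ} (hw : 2 ≤ w) (hw' : w < 256)
    (hn : Fintype.card α < 2 ^ w) :
    ∃ (label : α → ℕ) (D : List Bool), Function.Injective label ∧
      (∀ a, 1 ≤ label a ∧ label a ≤ Fintype.card α) ∧ D.length ≤ 256 * 2 ^ 256 ∧
      ∀ T : ℝ, 30 ≤ T → Represents queryProgram w r label D T := by
  classical
  let e := Fintype.equivFin α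
  let rep : α → α := fun a => (Quotient.mk r a).out
  have hrep : ∀ a b, r a b ↔ rep a = rep b := fun a b =>
    ⟨fun h => congrArg Quotient.out (Quotient.sound h), fun h => Quotient.exact (Quotient.out_inj.1 h)⟩
  -- Labels start at 1, so word 0 is a filler. Word `label a` is the number of the representative of
  -- the class of `a`.
  let cs : List ℕ := 0 :: List.ofFn fun i => (e (rep (e.symm i)) : ℕ)
  have hcs : ∀ c ∈ cs, c < 2 ^ w := by
    intro c hc
    rcases List.mem_cons.1 hc with rfl | hc
    · positivity
    · obtain ⟨i, rfl⟩ := (List.mem_ofFn' _ _).1 hc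
      exact (e _).2.trans hn
  have hlen : cs.length = Fintype.card α + 1 := by simp [cs]
  have hget : ∀ a, cs.getD ((e a : ℕ) + 1) 0 = e (rep a) := by
    intro a
    simp [cs, List.getD_eq_getElem?_getD]
  have hmem : ∀ k, packed w (bitList (w * cs.length) (Nat.ofDigits (2 ^ w) cs)) k =
      cs.getD k 0 := fun k => by
    rw [packed_bitList w (ofDigits_two_pow_lt _ _ hcs), ofDigits_two_pow_cell _ _ hcs]
  refine ⟨fun a => e a + 1, bitList (w * cs.length) (Nat.ofDigits (2 ^ w) cs), ?_, ?_, ?_, ?_⟩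
  · intro a b h
    exact e.injective (Fin.ext (Nat.succ_injective h))
  · exact fun a => ⟨Nat.succ_pos _, (e a).2⟩
  · have h1 : (2 : ℕ) ^ w ≤ 2 ^ 256 := Nat.pow_le_pow_right (by norm_num) hw'.le
    rw [bitList, List.length_map, List.length_range, hlen]
    exact Nat.mul_le_mul hw'.le (by omega)
  · intro T hT
    refine represents_of_reaches hrep (T := 30) (by exact_mod_cast hT) fun a b => ?_
    obtain ⟨c, h1, h2, h3⟩ := reaches_array (x := e a + 1) (y := e b + 1) hw hw'
      (mem := packed w (bitList (w * cs.length) (Nat.ofDigits (2 ^ w) cs))) fun k => by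
        rw [packed_bitList w (ofDigits_two_pow_lt _ _ hcs)]
        exact Nat.mod_lt _ (by positivity)
    refine ⟨c, h1, h2, ?_⟩
    simp only [h3, hmem, hget, Fin.val_inj, e.injective.eq_iff]

theorem four_mul_sq_le_two_pow {j : ℕ} (hj : 8 ≤ j) : 4 * j ^ 2 ≤ 2 ^ j := by
  induction j, hj using Nat.le_induction with
  | base => norm_num
  | succ j hj ih => rw [pow_succ 2 j]; nlinarith

/-- The least `j` such that `n` fits into a cell, but at least 8, from where on
`four_mul_sq_le_two_pow` applies. Minimality makes `2 ^ j` at most 2 lg n when `j` is not 8. -/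
theorem exists_parameter (n : ℕ) :
    ∃ j, 8 ≤ j ∧ n < 2 ^ 2 ^ j ∧ (j = 8 ∨ 2 ^ 2 ^ (j - 1) ≤ n) := by
  classical
  by_cases h : n < 2 ^ 2 ^ 8
  · exact ⟨8, le_rfl, h, .inl rfl⟩
  · have hex : ∃ j, n < 2 ^ 2 ^ j :=
      ⟨n, Nat.lt_two_pow_self.trans (Nat.pow_lt_pow_right (by norm_num) Nat.lt_two_pow_self)⟩
    have h8 : 8 < Nat.find hex := by
      by_contra! hle
      exact h ((Nat.find_spec hex).trans_le
        (Nat.pow_le_pow_right (by norm_num) (Nat.pow_le_pow_right (by norm_num) hle)))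
    exact ⟨Nat.find hex, h8.le, Nat.find_spec hex, .inr (not_lt.1 (Nat.find_min hex (by omega)))⟩

/-- The number of bits is of order `2 ^ (w / 2) * w`, hence below `2 ^ w` for `w ≥ 256`, so that bit
addresses can be computed in one word. -/
theorem address_bound {w n M j : ℕ} (hw : 256 ≤ w) (hn : n < 2 ^ w) (hj : 2 ^ j ≤ 2 * w)
    (hM : M ≤ 12 * (Nat.sqrt n + 1) + 14) : M * 2 ^ j < 2 ^ w := by
  obtain ⟨h, hh⟩ : ∃ h, h = w / 2 := ⟨_, rfl⟩
  have hh128 : 128 ≤ h := by omega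
  have key : 26 * (4 * h + 2) < 2 ^ h := by
    clear hh
    induction h, hh128 using Nat.le_induction with
    | base => norm_num
    | succ h hh ih => rw [pow_succ]; omega
  have hsqrt : Nat.sqrt n < 2 ^ (h + 1) := by
    rw [Nat.sqrt_lt', ← pow_mul]
    exact hn.trans_le (Nat.pow_le_pow_right (by norm_num) (by omega))
  have hbig : 14 ≤ 2 ^ (h + 1) := by rw [pow_succ]; omega
  calc M * 2 ^ j ≤ (13 * 2 ^ (h + 1)) * (2 * w) := Nat.mul_le_mul (by omega) hj
    _ ≤ (13 * 2 ^ (h + 1)) * (2 * (2 * h + 1)) := by gcongr; omega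
    _ = 2 ^ h * (26 * (4 * h + 2)) := by ring
    _ < 2 ^ h * 2 ^ h := by gcongr
    _ = 2 ^ (2 * h) := by rw [← pow_add]; congr 1; ring
    _ ≤ 2 ^ w := Nat.pow_le_pow_right (by norm_num) (by omega)

/-- The representation for large words. -/
theorem exists_buckets_representation {α : Type*} [Fintype α] (r : Setoid α) {n w j : ℕ}
    (hcard : Fintype.card α = n) (hn0 : 0 < n) (hw : 256 ≤ w) (hn : n < 2 ^ w)
    (hj : 8 ≤ j) (hnj : n < 2 ^ 2 ^ j) (hj' : j = 8 ∨ 2 ^ 2 ^ (j - 1) ≤ n) :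
    ∃ (label : α → ℕ) (D : List Bool), Function.Injective label ∧
      (∀ a, 1 ≤ label a ∧ label a ≤ n) ∧
      j * D.length ≤ 2 ^ j * (72 * (Nat.sqrt n + 1) + 14 * j) ∧
      ∀ T : ℝ, ((25 * j + 300 : ℕ) : ℝ) ≤ T → Represents queryProgram w r label D T := by
  classical
  have h4 := four_mul_sq_le_two_pow hj
  have hjw : 2 ^ j ≤ 2 * w := by
    rcases hj' with rfl | h
    · omega
    · have : 2 ^ (j - 1) < w := (Nat.pow_lt_pow_iff_right (by norm_num)).1 (h.trans_lt hn)
      obtain ⟨i, rfl⟩ : ∃ i, j = i + 1 := ⟨j - 1, by omega⟩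
      rw [pow_succ]
      simp only [Nat.add_sub_cancel] at this
      omega
  -- This follows from `4 * j ^ 2 ≤ 2 ^ j ≤ 2 * w`.
  have h2jj : 2 * j * j ≤ w := by nlinarith
  have hlt : j < w := by nlinarith
  obtain ⟨m, φ, hφ, hφr, hφc, hsum⟩ := exists_rank r
  rw [hcard] at hsum
  set F := (Finset.Icc 1 n).filter fun s => 0 < m s with hF
  have hsumF : ∑ s ∈ F, s * m s = n := by
    rw [← hsum]
    refine Finset.sum_subset (Finset.filter_subset _ _) fun s hs hs' => ?_
    have : m s = 0 := by
      by_contra h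
      exact hs' (Finset.mem_filter.2 ⟨hs, Nat.pos_of_ne_zero h⟩)
    simp [this]
  have hφF : ∀ a, (φ a).1 ∈ F ∧ (φ a).1 * m (φ a).1 ≤ n := by
    intro a
    obtain ⟨h1, h3, h2⟩ := hφr a
    rw [hcard] at h3
    have hm : 0 < m (φ a).1 := Nat.pos_of_mul_pos_left ((Nat.zero_le _).trans_lt h2)
    have hmem : (φ a).1 ∈ F := Finset.mem_filter.2 ⟨Finset.mem_Icc.2 ⟨h1, h3⟩, hm⟩
    refine ⟨hmem, ?_⟩
    rw [← hsumF]
    exact Finset.single_le_sum (f := fun s => s * m s) (fun _ _ => Nat.zero_le _) hmem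
  obtain ⟨N, ⟨L, hLN, hLsum, hLv, hLs⟩, hN⟩ := exists_covers (n := n) (R := Nat.sqrt n + 1) (m := m)
    (show 0 < j by omega) (by omega) (Nat.lt_succ_sqrt' n) F
    (fun s hs => ⟨(Finset.mem_Icc.1 (Finset.mem_filter.1 hs).1).1, (Finset.mem_filter.1 hs).2⟩) hsumF
  rw [hsumF] at hLsum
  have hL0 : 0 < L.length := by
    rcases L with _ | ⟨b, L⟩
    · simp at hLsum; omega
    · simp
  have hLn : L.length ≤ n := by
    have := List.length_le_sum_of_one_le (L.map Prod.fst) (by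
      intro x hx
      obtain ⟨b, hb, rfl⟩ := List.mem_map.1 hx
      exact (hLv b hb).1)
    rwa [hLsum, List.length_map] at this
  -- The bucket size is about the average weight of a block, and `k + 1` is `n / W` rounded up. The
  -- number of buckets is between one and two times the number of blocks.
  obtain ⟨W, hWdef⟩ : ∃ W, W = n / L.length := ⟨_, rfl⟩
  have hW0 : 0 < W := by rw [hWdef]; exact Nat.div_pos hLn hL0
  have hWL : L.length * W ≤ n := by rw [hWdef]; exact Nat.mul_div_le _ _
  have hWL' : n < L.length * (W + 1) := by
    rw [hWdef, mul_comm]; exact Nat.lt_mul_of_div_lt (Nat.lt_succ_self _) hL0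
  obtain ⟨k, hk⟩ : ∃ k, k = (n - 1) / W := ⟨_, rfl⟩
  have hk1 : k * W < n := by
    have := Nat.div_mul_le_self (n - 1) W
    rw [← hk] at this; omega
  have hk2 : n ≤ (k + 1) * W := by
    have := Nat.lt_mul_of_div_lt (show (n - 1) / W < k + 1 by omega) hW0
    rw [mul_comm] at this
    rw [mul_comm]; omega
  have hkL : L.length ≤ k + 1 := by
    by_contra! h
    nlinarith
  have hk3 : k + 1 ≤ 2 * L.length := by
    by_contra! h
    nlinarith
  -- Blocks of weight 0 fill up the list, because `exists_buckets` needs as many blocks as buckets.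
  set L' := L ++ List.replicate (k + 1 - L.length) ((0, (0, [])) : ℕ × Block) with hL'
  have hL'sum : (L'.map Prod.fst).sum = n := by simp [hL', hLsum]
  have hL'v : ∀ b ∈ L', b.1 ≤ n ∧ b.2.Valid j n := by
    intro b hb
    refine ⟨?_, ?_⟩
    · rw [← hL'sum]
      exact List.single_le_sum (fun _ _ => Nat.zero_le _) _ (List.mem_map_of_mem hb)
    · rcases List.mem_append.1 hb with hb | hb
      · exact (hLv b hb).2
      · rw [List.eq_of_mem_replicate hb]
        exact ⟨by simp, by simp, by simp⟩
  obtain ⟨Bs, hBs, hBv, hBget⟩ := exists_buckets W (k + 1) L' (by simp [hL']; omega)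
    (Nat.succ_pos _) (by rw [hL'sum]; simpa using hk1) (by rw [hL'sum]; exact hk2)
  rw [hL'sum] at hBget
  have hWn : W ≤ n := by rw [hWdef]; exact Nat.div_le_self _ _
  have hlen := length_allCells j W Bs
  rw [hBs] at hlen
  have hcells : HasCells w j (allCells j W Bs).length (fun c => (allCells j W Bs).getD c 0) _ :=
    hasCells_allCells (by omega) hn (Nat.pow_lt_pow_right (by norm_num) hlt) h2jj (by nlinarith) hnj
      hWn (fun B hB => by
        obtain ⟨h1, ⟨b, hb, h2, h3⟩, b', hb', h4⟩ := hBv B hB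
        exact ⟨h1.trans hWn, h2.trans (hL'v b hb).1, h3 ▸ (hL'v b hb).2, h4 ▸ (hL'v b' hb').2⟩)
      (address_bound hw hn hjw (by
        rw [hlen]
        have : 8 * N ≤ j * N := Nat.mul_le_mul_right _ hj
        have : j * (N - 1) ≤ 6 * (Nat.sqrt n + 1) := by rw [Nat.mul_sub_one]; omega
        have : 8 * (N - 1) ≤ j * (N - 1) := Nat.mul_le_mul_right _ hj
        omega))
  have hdec : ∀ a, ∃ x, x < n ∧ Decodes n j W (allCells j W Bs).length
      (fun c => (allCells j W Bs).getD c 0) x (φ a).1 (φ a).2 ∧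
      ∃ B, Bs[x / W]? = some B ∧
        scan (B.get (x % W)).1.1 (B.get (x % W)).1.2 (B.get (x % W)).2 = φ a := by
    intro a
    obtain ⟨h1, h2⟩ := hφF a
    have h3 := (hφr a).2.2
    obtain ⟨b, hb, ρ, hρ, hscan⟩ := hLs _ h1 _ h3
    have hbL : b ∈ L' := List.mem_append_left _ hb
    obtain ⟨x, hx, B, hB, hget⟩ := hBget b hbL ρ hρ
    refine ⟨x, hx, decodes_of_bucket hB hget (hLv b hb).2 hscan hx ?_ (by omega)
      (hρ.le.trans (hL'v b hbL).1), B, hB, by rw [hget]; exact hscan⟩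
    exact (Finset.mem_Icc.1 (Finset.mem_filter.1 h1).1).2
  choose pos hpos hdec B hB hscan using hdec
  refine ⟨fun a => pos a + 1, _, ?_, fun a => ⟨Nat.succ_pos _, hpos a⟩, ?_, fun T hT =>
    represents_of_reaches hφc hT fun a b => reaches_answer hcells hw hlt hn rfl rfl
      (hdec a) (hdec b)⟩
  -- Equal labels lie at the same position of the same bucket and so decode to the same value of
  -- `φ`, which is injective.
  · intro a b h
    have h' : pos a = pos b := Nat.succ_injective h
    have hBab : B a = B b := Option.some.inj (by rw [← hB a, ← hB b, h'])
    exact hφ (by rw [← hscan a, ← hscan b, hBab, h'])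
  · rw [bitList, List.length_map, List.length_range, hlen]
    have h5 : j * (k + 1) ≤ 12 * (Nat.sqrt n + 1) + 2 * j := by
      calc j * (k + 1) ≤ j * (2 * N) := Nat.mul_le_mul_left _ (by omega)
        _ = 2 * (j * N) := by ring
        _ ≤ _ := by omega
    calc j * (2 ^ j * (2 + 6 * (k + 1))) = 2 ^ j * (2 * j + 6 * (j * (k + 1))) := by ring
      _ ≤ _ := Nat.mul_le_mul_left _ (by omega)

/-! ### Real estimates and the final constant -/

/-- From 8 ≤ n² follows lg n ≥ 3/2, and from 2 ≤ (3/2)² the claim. It lets additive constants be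
absorbed into multiples of lg lg n. -/
theorem half_le_logb_logb {n : ℕ} (hn : 3 ≤ n) : 1 / 2 ≤ Real.logb 2 (Real.logb 2 n) := by
  have h3 : (3 : ℝ) ≤ n := by exact_mod_cast hn
  have h1 : 3 / 2 ≤ Real.logb 2 n := by
    have h : Real.logb 2 8 ≤ Real.logb 2 ((n : ℝ) ^ 2) :=
      Real.logb_le_logb_of_le (by norm_num) (by norm_num) (by nlinarith)
    rw [Real.logb_pow, show (8 : ℝ) = 2 ^ 3 by norm_num, Real.logb_pow,
      Real.logb_self_eq_one (by norm_num)] at h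
    norm_num at h
    linarith
  have h : Real.logb 2 2 ≤ Real.logb 2 (Real.logb 2 n ^ 2) :=
    Real.logb_le_logb_of_le (by norm_num) (by norm_num) (by nlinarith)
  rw [Real.logb_pow, Real.logb_self_eq_one (by norm_num)] at h
  norm_num at h
  linarith

theorem logb_two_le_self {x : ℝ} (hx : 1 ≤ x) : Real.logb 2 x ≤ x := by
  rw [Real.logb_le_iff_le_rpow (by norm_num) (by linarith)]
  -- Bernoulli's inequality gives 1 + x ≤ 2 ^ x.
  have h := one_add_mul_self_le_rpow_one_add (show (-1 : ℝ) ≤ 1 by norm_num) hx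
  norm_num at h
  linarith

theorem parameter_bounds {n j : ℕ} (hn : 3 ≤ n) (hnj : n < 2 ^ 2 ^ j)
    (hj' : j = 8 ∨ 2 ^ 2 ^ (j - 1) ≤ n) :
    (j : ℝ) ≤ 16 * Real.logb 2 (Real.logb 2 n) ∧ Real.logb 2 (Real.logb 2 n) ≤ j ∧
      (2 : ℝ) ^ j ≤ 256 * Real.logb 2 n := by
  have hll := half_le_logb_logb hn
  have h3 : (3 : ℝ) ≤ n := by exact_mod_cast hn
  have hl1 : 1 ≤ Real.logb 2 n := by
    rw [Real.le_logb_iff_rpow_le (by norm_num) (by linarith)]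
    norm_num
    linarith
  refine ⟨?_, ?_, ?_⟩
  · rcases hj' with rfl | h
    · push_cast; linarith
    · rcases j with _ | j
      · push_cast; linarith
      have h1 : ((2 ^ j : ℕ) : ℝ) ≤ Real.logb 2 n := by
        rw [Real.le_logb_iff_rpow_le (by norm_num) (by linarith), Real.rpow_natCast]
        exact_mod_cast h
      have h2 : (j : ℝ) ≤ Real.logb 2 (Real.logb 2 n) := by
        rw [Real.le_logb_iff_rpow_le (by norm_num) (by linarith), Real.rpow_natCast]
        exact_mod_cast h1
      push_cast; linarith
  · have h1 : Real.logb 2 n ≤ ((2 ^ j : ℕ) : ℝ) := by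
      rw [Real.logb_le_iff_le_rpow (by norm_num) (by linarith), Real.rpow_natCast]
      exact_mod_cast hnj.le
    rw [Real.logb_le_iff_le_rpow (by norm_num) (by linarith), Real.rpow_natCast]
    exact_mod_cast h1
  · rcases hj' with rfl | h
    · norm_num; linarith
    · rcases j with _ | j
      · norm_num; linarith
      have h1 : ((2 ^ j : ℕ) : ℝ) ≤ Real.logb 2 n := by
        rw [Real.le_logb_iff_rpow_le (by norm_num) (by linarith), Real.rpow_natCast]
        exact_mod_cast h
      push_cast at h1
      rw [pow_succ]
      linarith

/-- Needed to absorb the summand `14 * j` in the number of bits, which comes from rounding and from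
the header. -/
theorem parameter_le_sqrt {n j : ℕ} (hj' : j = 8 ∨ 2 ^ 2 ^ (j - 1) ≤ n) :
    j ≤ 8 * (Nat.sqrt n + 1) := by
  rcases hj' with rfl | h
  · omega
  · rcases j with _ | _ | j
    · omega
    · omega
    · have h1 : 2 ^ 2 ^ j ≤ Nat.sqrt n := by
        rw [Nat.le_sqrt', ← pow_mul, ← pow_succ]
        exact h
      have h2 : j < 2 ^ j := Nat.lt_two_pow_self
      have h3 : 2 ^ j < 2 ^ 2 ^ j := Nat.lt_two_pow_self
      omega

end WordRAM

theorem theorem4 :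
    ∃ (P : WordRAM.Program) (C : ℝ),
      ∀ n w : ℕ, 3 ≤ n → n < 2 ^ w →
        ∀ (α : Type*) [Fintype α] (r : Setoid α), Fintype.card α = n →
          ∃ (label : α → ℕ) (D : List Bool),
            Function.Injective label ∧
            (∀ a, 1 ≤ label a ∧ label a ≤ n) ∧
            (D.length : ℝ) ≤ C * (√(n : ℝ) * Real.logb 2 n / Real.logb 2 (Real.logb 2 n)) ∧
            WordRAM.Represents P w r label D (C * Real.logb 2 (Real.logb 2 n)) := by
  -- The first bound is the size of the array for small words. The second is 256 · 200 · 2, from the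
  -- cell width, the number of cells and √n + 1 ≤ 2√n; it also covers the running times. Only these
  -- inequalities are kept, so the huge number is not computed with.
  obtain ⟨C, hC, hC'⟩ : ∃ C : ℝ, 256 * 2 ^ 256 ≤ C ∧ 102400 ≤ C :=
    ⟨256 * 2 ^ 256, le_rfl, by norm_num⟩
  refine ⟨WordRAM.queryProgram, C, fun n w hn hnw α _ r hcard => ?_⟩
  have hll := WordRAM.half_le_logb_logb hn
  set ll := Real.logb 2 (Real.logb 2 n) with hlldef
  have h3 : (3 : ℝ) ≤ n := by exact_mod_cast hn
  have hl0 : 1 ≤ Real.logb 2 n := by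
    rw [Real.le_logb_iff_rpow_le (by norm_num) (by linarith)]
    norm_num
    linarith
  have hsqrt : 1 ≤ √(n : ℝ) := Real.one_le_sqrt.2 (by linarith)
  have hw : 2 ≤ w := by
    by_contra! h
    have : 2 ^ w ≤ 2 ^ 1 := Nat.pow_le_pow_right (by norm_num) (by omega)
    omega
  rcases lt_or_ge w 256 with hw' | hw'
  · obtain ⟨label, D, h1, h2, h4, h5⟩ := WordRAM.exists_array r hw hw' (hcard ▸ hnw)
    rw [hcard] at h2
    refine ⟨label, D, h1, h2, ?_, h5 _ (by nlinarith)⟩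
    -- The array has a constant number of bits, so it suffices that the required bound is at least
    -- `C`.
    have h6 : 1 ≤ √(n : ℝ) * Real.logb 2 n / ll := by
      rw [one_le_div (by linarith)]
      have := WordRAM.logb_two_le_self hl0
      nlinarith
    have h7 : (D.length : ℝ) ≤ 256 * 2 ^ 256 := by exact_mod_cast h4
    calc (D.length : ℝ) ≤ 256 * 2 ^ 256 := h7
      _ ≤ C * 1 := by rwa [mul_one]
      _ ≤ _ := by gcongr
  · obtain ⟨j, hj, hnj, hj'⟩ := WordRAM.exists_parameter n
    obtain ⟨b1, b2, b3⟩ := WordRAM.parameter_bounds hn hnj hj'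
    rw [← hlldef] at b1 b2
    have b4 := WordRAM.parameter_le_sqrt hj'
    obtain ⟨label, D, h1, h2, h4, h5⟩ := WordRAM.exists_buckets_representation r hcard (by omega)
      hw' hnw hj hnj hj'
    refine ⟨label, D, h1, h2, ?_, h5 _ ?_⟩
    · have hs : ((Nat.sqrt n : ℕ) : ℝ) ≤ √(n : ℝ) := Real.nat_sqrt_le_real_sqrt
      have h6 : j * D.length ≤ 2 ^ j * (200 * (Nat.sqrt n + 1)) :=
        h4.trans (Nat.mul_le_mul_left _ (by omega))
      have h7 : (j : ℝ) * D.length ≤ 2 ^ j * (200 * (Nat.sqrt n + 1)) := by exact_mod_cast h6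
      rw [← mul_div_assoc, le_div_iff₀ (by linarith)]
      calc (D.length : ℝ) * ll ≤ D.length * j := by gcongr
        _ = j * D.length := mul_comm _ _
        _ ≤ 2 ^ j * (200 * (Nat.sqrt n + 1)) := h7
        _ ≤ (256 * Real.logb 2 n) * (200 * (√(n : ℝ) + √(n : ℝ))) := by gcongr
        _ = 102400 * (√(n : ℝ) * Real.logb 2 n) := by ring
        _ ≤ C * (√(n : ℝ) * Real.logb 2 n) := by
          gcongr
    · push_cast
      nlinarith
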